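/- Let $0\le d<n$ be integers and let $L\subset\mathbb{P}^n=\mathbb{P}^n_{\mathbb{C}}$ be a $d$-dimensional linear subspace that is not contained in any coordinate hyperplane. Let $A\in\mathbb{C}^{(d+1)\times(n+1)}$ be a matrix whose projectivized row span is $L$, and let $B\in\mathbb{C}^{(n+1)\times(n-d)}$ be a matrix whose columns form a basis of $\ker A$. Let $M(L)$ be the matroid on $\{0,\dots,n\}$ represented by the columns of $A$, i.e. a set of indices is independent if the corresponding columns of $A$ are linearly independent (equivalently, the corresponding coordinate functions are linearly independent on the linear subspace of $\mathbb{C}^{n+1}$ over $L$). Assume that $M(L)$ has no coloops (equivalently, no row of $B$ is zero). Let $L^{-1}\subset\mathbb{P}^n$ be the reciprocal linear space, that is, the Zariski closure of $\{(x_0^{-1}:\cdots:x_n^{-1}) : (x_0:\cdots:x_n)\in L,\ x_0\cdots x_n\neq 0\}$. Let $\nabla(L^{-1})\subset(\mathbb{P}^n)^\vee$ be its projective dual variety, that is, the Zariski closure of the set of all $z=(z_0:\cdots:z_n)$ for which the hyperplane $\{x : \sum_i z_i x_i=0\}$ contains the projective tangent space of $L^{-1}$ at some regular point. The variety $L^{-1}$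 is called dual defective if $\nabla(L^{-1})$ has codimension greater than one in $(\mathbb{P}^n)^\vee$, and $\nabla(L^{-1})$ is called a hypersurface if it is the zero locus of a single nonzero homogeneous polynomial of positive degree. For $t=(t_0,\dots,t_d)$ and $u=(u_0,\dots,u_{n-d-1})$ consider the $(n+1)\times(n+1)$ matrix $$\mathcal{J}_L(t,u)=\begin{pmatrix}\operatorname{diag}(Bu)\,A^\top & \operatorname{diag}(A^\top t)\,B\end{pmatrix}.$$ Then: 1. $L^{-1}$ is dual defective if and only if all $n\times n$ minors of $\mathcal{J}_L(t,u)$ are identically zero, i.e. are zero as polynomials in $\mathbb{C}[t_0,\dots,t_d,u_0,\dots,u_{n-d-1}]$. 2. Equivalently, $\nabla(L^{-1})$ is a hypersurface if and only if $\mathcal{J}_L(t^*,u^*)$ has rank $n$ over $\mathbb{C}$ for some $(t^*,u^*)\in\mathbb{P}^d\times\mathbb{P}^{n-d-1}$. -/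

import Mathlib

open scoped LinearAlgebra.Projectivization

noncomputable section

/-- Complex projective `n`-space with homogeneous coordinates indexed by `0, …, n`. The dual
projective space is also written in coordinates: `z` stands for the hyperplane `∑ i, z i * x i = 0`. -/
abbrev PSpace (n : ℕ) : Type := ℙ ℂ (Fin (n + 1) → ℂ)

namespace PSpace

variable {n : ℕ}

/-- A homogeneous form `f` vanishes at the point `p`. For homogeneous `f` this does not depend on
the representative; the predicate is only used for homogeneous `f`. -/
def VanishesAt (f : MvPolynomial (Fin (n + 1)) ℂ) (p : PSpace n) : Prop :=
  MvPolynomial.eval p.rep f = 0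

/-- A polynomial is a form if it is homogeneous of some degree. -/
def IsForm (f : MvPolynomial (Fin (n + 1)) ℂ) : Prop :=
  ∃ k : ℕ, f.IsHomogeneous k

/-- The common zero locus in projective space of a set of polynomials. -/
def zeroLocus (S : Set (MvPolynomial (Fin (n + 1)) ℂ)) : Set (PSpace n) :=
  {p | ∀ f ∈ S, VanishesAt f p}

/-- The closed sets of the Zariski topology: zero loci of sets of forms. -/
def IsAlgebraicSet (Z : Set (PSpace n)) : Prop :=
  ∃ S : Set (MvPolynomial (Fin (n + 1)) ℂ), (∀ f ∈ S, IsForm f) ∧ Z = zeroLocus S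

theorem isAlgebraicSet_empty : IsAlgebraicSet (∅ : Set (PSpace n)) := by
  refine ⟨{1}, ?_, ?_⟩
  · rintro f rfl
    exact ⟨0, MvPolynomial.isHomogeneous_one _ _⟩
  · ext p
    simp [zeroLocus, VanishesAt]

theorem isAlgebraicSet_sInter (T : Set (Set (PSpace n))) (hT : ∀ Z ∈ T, IsAlgebraicSet Z) :
    IsAlgebraicSet (⋂₀ T) := by
  refine ⟨{f | IsForm f ∧ ∃ Z ∈ T, ∀ p ∈ Z, VanishesAt f p}, fun f hf => hf.1, ?_⟩
  ext p
  constructor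
  · rintro hp f ⟨-, Z, hZ, hfZ⟩
    exact hfZ p (hp Z hZ)
  · intro hp Z hZ
    obtain ⟨S, hS, rfl⟩ := hT Z hZ
    exact fun f hf => hp f ⟨hS f hf, zeroLocus S, hZ, fun q hq => hq f hf⟩

theorem isAlgebraicSet_union (Y Z : Set (PSpace n)) (hY : IsAlgebraicSet Y)
    (hZ : IsAlgebraicSet Z) : IsAlgebraicSet (Y ∪ Z) := by
  obtain ⟨S, hS, rfl⟩ := hY
  obtain ⟨T, hT, rfl⟩ := hZ
  refine ⟨{h | ∃ f ∈ S, ∃ g ∈ T, h = f * g}, ?_, ?_⟩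
  · rintro h ⟨f, hf, g, hg, rfl⟩
    obtain ⟨k, hk⟩ := hS f hf
    obtain ⟨l, hl⟩ := hT g hg
    exact ⟨k + l, hk.mul hl⟩
  · ext p
    constructor
    · rintro (hp | hp) h ⟨f, hf, g, hg, rfl⟩
      · have := hp f hf
        simp_all [VanishesAt]
      · have := hp g hg
        simp_all [VanishesAt]
    · intro hp
      by_contra hcon
      simp only [Set.mem_union, not_or, zeroLocus, Set.mem_ofPred_eq, not_forall] at hcon
      obtain ⟨⟨f, hf, hfp⟩, g, hg, hgp⟩ := hcon
      have := hp (f * g) ⟨f, hf, g, hg, rfl⟩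
      simp only [VanishesAt, map_mul, mul_eq_zero] at this
      exact this.elim hfp hgp

/-- The Zariski topology on projective space. -/
instance zariskiTopology : TopologicalSpace (ℙ ℂ (Fin (n + 1) → ℂ)) :=
  TopologicalSpace.ofClosed {Z | IsAlgebraicSet (n := n) Z} isAlgebraicSet_empty
    isAlgebraicSet_sInter (fun Y hY Z hZ => isAlgebraicSet_union Y Z hY hZ)

/-- The codimension in projective space of a set `Z`: the infimum, over the irreducible closed
subsets `Y` of `Z`, of the supremum of the lengths of chains of irreducible closed sets
`Y = Y₀ ⊂ Y₁ ⊂ ⋯ ⊂ Yₖ`. -/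
def codim (Z : Set (PSpace n)) : ℕ∞ :=
  ⨅ (Y : TopologicalSpace.IrreducibleCloseds (PSpace n)) (_ : (Y : Set (PSpace n)) ⊆ Z),
    Order.coheight Y

/-- A hypersurface is the zero locus of one nonzero form of positive degree. -/
def IsHypersurface (Z : Set (PSpace n)) : Prop :=
  ∃ (k : ℕ) (f : MvPolynomial (Fin (n + 1)) ℂ),
    0 < k ∧ f ≠ 0 ∧ f.IsHomogeneous k ∧ Z = zeroLocus {f}

/-- The linear subspace of `ℂⁿ⁺¹` whose projectivization is the embedded projective tangent space
of `X` at `p`: the vectors annihilated by the differentials at `p` of all forms vanishing on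
`X`. -/
def tangentSpace (X : Set (PSpace n)) (p : PSpace n) : Submodule ℂ (Fin (n + 1) → ℂ) where
  carrier := {w | ∀ f : MvPolynomial (Fin (n + 1)) ℂ, IsForm f → (∀ q ∈ X, VanishesAt f q) →
    ∑ j, MvPolynomial.eval p.rep (MvPolynomial.pderiv j f) * w j = 0}
  zero_mem' := by
    intro f _ _
    simp
  add_mem' := by
    intro v w hv hw f hf hfX
    simp only [Pi.add_apply, mul_add, Finset.sum_add_distrib, hv f hf hfX, hw f hf hfX, add_zero]
  smul_mem' := by
    intro c w hw f hf hfX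
    simp only [Pi.smul_apply, smul_eq_mul, mul_left_comm _ c, ← Finset.mul_sum, hw f hf hfX,
      mul_zero]

/-- The regular points of an irreducible closed set `X`: the points of `X` at which the dimension
of the tangent space takes its minimal value on `X`, that is, at which the Jacobian matrix of the
equations of `X` has maximal rank. (For irreducible `X` over `ℂ` the minimal dimension of the
projective tangent space is `dim X`, and that of the linear space `tangentSpace X p` is
`dim X + 1`.) -/
def regularPoints (X : Set (PSpace n)) : Set (PSpace n) :=
  {p | p ∈ X ∧ ∀ q ∈ X,
    Module.finrank ℂ (tangentSpace X p) ≤ Module.finrank ℂ (tangentSpace X q)}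

/-- The conormal bundle of the regular locus of `X`: pairs of a regular point `x` of `X` and a
hyperplane `z` containing the projective tangent space of `X` at `x`. -/
def conormal (X : Set (PSpace n)) : Set (PSpace n × PSpace n) :=
  {xz | xz.1 ∈ regularPoints X ∧ ∀ w ∈ tangentSpace X xz.1, ∑ i, xz.2.rep i * w i = 0}

/-- The projective dual variety of `X`: the Zariski closure of the set of hyperplanes
tangent to `X` at a regular point. -/
def dualVariety (X : Set (PSpace n)) : Set (PSpace n) :=
  closure (Prod.snd '' conormal X)

/-- `X` is dual defective if its dual variety has codimension greater than one. -/
def IsDualDefective (X : Set (PSpace n)) : Prop :=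
  1 < codim (dualVariety X)

/-- The reciprocal linear space `L⁻¹` of the projective linear space given by a subspace `L` of
`ℂⁿ⁺¹`: the Zariski closure of the set of points `(1/x₀ : ⋯ : 1/xₙ)`, for `x ∈ L` with
all coordinates nonzero. -/
def reciprocal (L : Submodule ℂ (Fin (n + 1) → ℂ)) : Set (PSpace n) :=
  closure {p | ∃ x ∈ L, (∀ i, x i ≠ 0) ∧
    ∃ h : (fun i => (x i)⁻¹) ≠ 0, p = Projectivization.mk ℂ (fun i => (x i)⁻¹) h}

/-- The restriction to `L` of the `i`-th coordinate function. -/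
def coordOn (L : Submodule ℂ (Fin (n + 1) → ℂ)) (i : Fin (n + 1)) : Module.Dual ℂ L :=
  (LinearMap.proj i : (Fin (n + 1) → ℂ) →ₗ[ℂ] ℂ) ∘ₗ L.subtype

theorem linearIndepOn_augment {ι V : Type*} [Finite ι] [AddCommGroup V] [Module ℂ V]
    (v : ι → V) {I J : Set ι} (hI : LinearIndepOn ℂ v I) (hJ : LinearIndepOn ℂ v J)
    (hIJ : I.ncard < J.ncard) : ∃ e ∈ J, e ∉ I ∧ LinearIndepOn ℂ v (insert e I) := by
  by_contra! hcon
  have key : ∀ e ∈ J, v e ∈ Submodule.span ℂ (v '' I) := by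
    intro e he
    by_cases heI : e ∈ I
    · exact Submodule.subset_span ⟨e, heI, rfl⟩
    · by_contra hsp
      exact hcon e he heI (hI.insert hsp)
  have hle : Submodule.span ℂ (v '' J) ≤ Submodule.span ℂ (v '' I) := by
    rw [Submodule.span_le]
    rintro _ ⟨e, he, rfl⟩
    exact key e he
  have : Module.Finite ℂ (Submodule.span ℂ (v '' I)) :=
    Module.Finite.span_of_finite ℂ (Set.toFinite _)
  have hfin := Submodule.finrank_mono hle
  have card : ∀ K : Set ι, LinearIndepOn ℂ v K →
      Module.finrank ℂ (Submodule.span ℂ (v '' K)) = K.ncard := by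
    intro K hK
    have := Fintype.ofFinite K
    have h := finrank_span_eq_card hK
    rw [Set.ncard_eq_toFinset_card', Set.toFinset_card, ← h, Set.image_eq_range]
  rw [card I hI, card J hJ] at hfin
  omega

/-- The matroid `M(L)` on `{0, …, n}`: a set of coordinates is independent if the corresponding
coordinate functions are linearly independent on `L`. If `L` is the row span of a matrix `A`, this
is linear independence of the corresponding columns of `A`. -/
def matroid (L : Submodule ℂ (Fin (n + 1) → ℂ)) : Matroid (Fin (n + 1)) :=
  (IndepMatroid.ofFinite (E := Set.univ) Set.finite_univ
    (fun I => LinearIndepOn ℂ (coordOn L) I)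
    (linearIndepOn_empty ℂ _)
    (fun _ _ hJ hIJ => hJ.mono hIJ)
    (fun _ _ hI hJ hIJ => linearIndepOn_augment _ hI hJ hIJ)
    (fun I _ => Set.subset_univ I)).matroid

/-- The `(n + 1) × (n + 1)` matrix `(diag(B u) Aᵀ | diag(Aᵀ t) B)`. -/
def jacobian {R : Type*} [CommRing R] {d m : ℕ} (A : Matrix (Fin (d + 1)) (Fin (n + 1)) R)
    (B : Matrix (Fin (n + 1)) (Fin m) R) (t : Fin (d + 1) → R) (u : Fin m → R) :
    Matrix (Fin (n + 1)) (Fin (d + 1) ⊕ Fin m) R :=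
  Matrix.fromCols (Matrix.diagonal (B.mulVec u) * A.transpose)
    (Matrix.diagonal (A.transpose.mulVec t) * B)

/-- The matrix `jacobian` with polynomial entries, `t` and `u` being the variables. -/
def genericJacobian {d m : ℕ} (A : Matrix (Fin (d + 1)) (Fin (n + 1)) ℂ)
    (B : Matrix (Fin (n + 1)) (Fin m) ℂ) :
    Matrix (Fin (n + 1)) (Fin (d + 1) ⊕ Fin m) (MvPolynomial (Fin (d + 1) ⊕ Fin m) ℂ) :=
  jacobian (A.map MvPolynomial.C) (B.map MvPolynomial.C)
    (fun i => MvPolynomial.X (Sum.inl i)) (fun j => MvPolynomial.X (Sum.inr j))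

end PSpace

end

/-! At a point `1/x` with `x ∈ L` in the torus, the tangent space of the cone over `L⁻¹` is `x⁻² L`
(coordinatewise). The hyperplanes tangent there are therefore `z = x² v` with `v` orthogonal to `L`,
that is, `x = Aᵀ t` and `v = B u`. Hence the dual variety is the closure of the image of `(t, u) ↦
(Aᵀ t)² (B u)`, a map given by `n + 1` cubic forms in `n + 1` variables
(`PSpace.dualVariety_reciprocal_eq`).

The Jacobian matrix of this map is `diag(Aᵀ t) · J · diag(2, 1)`, where `J` is the matrix of the
theorem and `2`, `1` are the factors of the two blocks of columns. Since no coordinate of `Aᵀ t` is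
the zero polynomial, a minor of the Jacobian matrix vanishes identically exactly when the same minor
of `J` does. The vector `(t, -u)` lies in the kernel of `J`, so the `n + 1` cubics are algebraically
dependent, and the image closure lies in the zero locus of an irreducible form.

The image closure equals that zero locus exactly when some `n` of the cubics are algebraically
independent (`PSpace.isHypersurface_imageClosure_iff`); otherwise it is a proper irreducible closed
subset and has codimension greater than one (`PSpace.one_lt_codim_imageClosure_iff`). By the
Jacobian criterion in characteristic zero, independence of some `n` cubics means that some `n × n`
minor of `J` is a nonzero polynomial, or equivalently that `J` has rank `n` at some point. -/

noncomputable section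

/-! ### The Jacobian criterion for algebraic independence -/

open MvPolynomial

/-- In characteristic zero, a derivation vanishes on the elements that are algebraic over a ring
of constants. -/
theorem Derivation.eq_zero_of_isAlgebraic {S R : Type*} [CommRing S] [CommRing R] [IsDomain R]
    [Algebra S R] [FaithfulSMul S R] [CharZero R] (D : Derivation S R R) {x : R}
    (hx : IsAlgebraic S x) : D x = 0 := by
  have hinj : Function.Injective (algebraMap S R) := FaithfulSMul.algebraMap_injective S R
  have : IsDomain S := hinj.isDomain _
  have : CharZero S := ⟨fun a b h => Nat.cast_injective (R := R) (by
    simpa using congrArg (algebraMap S R) h)⟩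
  by_contra hD
  -- Induction on the degree: if `p(x) = 0`, then `0 = D(p(x)) = p'(x) D x`, so `p'(x) = 0` and `p'
  -- = 0` by induction. In characteristic zero `p` is then constant, hence zero.
  have key : ∀ k : ℕ, ∀ p : Polynomial S, p.natDegree ≤ k → Polynomial.aeval x p = 0 → p = 0 := by
    intro k
    induction k with
    | zero =>
      intro p hp hpx
      rw [Polynomial.eq_C_of_natDegree_le_zero hp] at hpx ⊢
      rw [Polynomial.aeval_C] at hpx
      rw [(map_eq_zero_iff _ hinj).1 hpx, map_zero]
    | succ k ih =>
      intro p hp hpx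
      have h1 := D.map_aeval p x
      rw [hpx, map_zero, smul_eq_mul] at h1
      have h2 := (mul_eq_zero.1 h1.symm).resolve_right hD
      have h3 := ih _ ((Polynomial.natDegree_derivative_le p).trans (by omega)) h2
      have h4 := Polynomial.derivative_eq_zero.1 h3
      rw [Polynomial.eq_C_of_natDegree_eq_zero h4] at hpx ⊢
      rw [Polynomial.aeval_C] at hpx
      rw [(map_eq_zero_iff _ hinj).1 hpx, map_zero]
  obtain ⟨p, hp0, hp⟩ := hx
  exact hp0 (key _ p le_rfl hp)

/-- A derivation that vanishes on a set, regarded as a derivation over the subalgebra generated by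
that set. -/
def Derivation.overAdjoin {K R : Type*} [CommRing K] [CommRing R] [Algebra K R]
    (D : Derivation K R R) (s : Set R) (hs : ∀ x ∈ s, D x = 0) :
    Derivation (Algebra.adjoin K s) R R where
  toFun := D
  map_add' := D.map_add
  map_smul' := by
    intro a x
    have ha : D (a : R) = 0 :=
      Derivation.eqOn_adjoin (D1 := D) (D2 := 0) (fun y hy => by simpa using hs y hy) a.2
    change D ((a : R) * x) = (a : R) * D x
    rw [D.leibniz, ha, smul_zero, add_zero, smul_eq_mul]
  map_one_eq_zero' := D.map_one_eq_zero
  leibniz' := D.leibniz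

section Jacobian

variable {K : Type*} [Field K] {σ ι : Type*}

/-- The chain rule for a polynomial in polynomials. -/
theorem MvPolynomial.pderiv_aeval [Fintype ι] (y : ι → MvPolynomial σ K) (c : σ)
    (G : MvPolynomial ι K) :
    pderiv c (aeval y G) = ∑ i, aeval y (pderiv i G) * pderiv c (y i) := by
  classical
  induction G using MvPolynomial.induction_on with
  | C a => simp
  | add p q hp hq => simp only [map_add, hp, hq, add_mul, Finset.sum_add_distrib]
  | mul_X p j h =>
    simp only [map_mul, aeval_X, Derivation.leibniz, h, smul_eq_mul, pderiv_X, map_add, add_mul,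
      Finset.sum_add_distrib, Finset.mul_sum]
    congr 1
    · rw [Finset.sum_eq_single j]
      · simp
      · intro b _ hb
        simp [hb.symm]
      · simp
    · exact Finset.sum_congr rfl fun i _ => by ring

theorem MvPolynomial.totalDegree_pderiv_lt {G : MvPolynomial ι K} {i : ι}
    (h : pderiv i G ≠ 0) : (pderiv i G).totalDegree < G.totalDegree := by
  obtain ⟨m, hm, hdeg⟩  := Finset.exists_mem_eq_sup (pderiv i G).support (by simpa using h)
    (fun m => m.sum fun _ e => e)
  have hdeg' : (pderiv i G).totalDegree = m.sum fun _ e => e := hdeg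
  rw [hdeg']
  rw [mem_support_iff, coeff_pderiv] at hm
  have := le_totalDegree (p := G) (s := m + Finsupp.single i 1)
    (mem_support_iff.2 (left_ne_zero_of_mul hm))
  rw [Finsupp.sum_add_index' (fun _ => rfl) (fun _ _ _ => rfl), Finsupp.sum_single_index rfl] at this
  omega

/-- If `m i ≠ 0`, the coefficient of `G` at `m` times the nonzero number `m i` is a coefficient of
`pderiv i G`. -/
theorem MvPolynomial.eq_C_of_pderiv_eq_zero [CharZero K] {G : MvPolynomial ι K}
    (h : ∀ i, pderiv i G = 0) : G = C (coeff 0 G) := by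
  classical
  ext m
  rw [coeff_C]
  split_ifs with hm
  · rw [hm]
  · obtain ⟨i, hi⟩ : ∃ i, m i ≠ 0 := by
      by_contra! hcon
      exact hm (Finsupp.ext hcon).symm
    have h1 := coeff_pderiv (i := i) G (m - Finsupp.single i 1)
    have h2 : m - Finsupp.single i 1 + Finsupp.single i 1 = m :=
      tsub_add_cancel_of_le (by simpa using Nat.one_le_iff_ne_zero.2 hi)
    rw [h, coeff_zero, h2] at h1
    refine (mul_eq_zero.1 h1.symm).resolve_right ?_
    exact Nat.cast_add_one_ne_zero _

/-- Polynomials with a nonzero maximal minor of the Jacobian matrix are algebraically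
independent. -/
theorem AlgebraicIndependent.of_det_pderiv_ne_zero [CharZero K] [Fintype ι] [DecidableEq ι]
    (y : ι → MvPolynomial σ K) (c : ι → σ)
    (h : (Matrix.of fun i j => pderiv (c j) (y i)).det ≠ 0) : AlgebraicIndependent K y := by
  rw [algebraicIndependent_iff]
  -- Induction on the degree of a relation `G`. By the chain rule the row vector of all
  -- `(∂G/∂yᵢ)(y)` is killed by an invertible matrix, so the partial derivatives of `G` are
  -- relations of smaller degree, hence zero, and `G` is constant.
  have key : ∀ k : ℕ, ∀ G : MvPolynomial ι K, G.totalDegree < k → aeval y G = 0 → G = 0 := by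
    intro k
    induction k with
    | zero => intro G hG; omega
    | succ k ih =>
      intro G hG hGy
      have h1 : ∀ i, pderiv i G = 0 := by
        have h2 : (fun i => aeval y (pderiv i G)) = 0 := by
          refine Matrix.eq_zero_of_vecMul_eq_zero h ?_
          ext1 j
          have := MvPolynomial.pderiv_aeval y (c j) G
          rw [hGy, map_zero] at this
          simpa only [Matrix.vecMul, dotProduct, Matrix.of_apply, Pi.zero_apply] using this.symm
        intro i
        by_contra hne
        have := totalDegree_pderiv_lt hne
        exact hne (ih _ (by omega) (congrFun h2 i))
      rw [eq_C_of_pderiv_eq_zero h1] at hGy ⊢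
      rw [aeval_C, algebraMap_eq] at hGy
      rw [C_eq_zero.1 hGy, map_zero]
  exact fun G hG => key _ G (Nat.lt_succ_self _) hG

/-- The Jacobian determinant of a transcendence basis of a polynomial ring is nonzero. -/
theorem IsTranscendenceBasis.det_pderiv_ne_zero [CharZero K] [Fintype ι] [DecidableEq ι]
    {b : ι → MvPolynomial σ K} (hb : IsTranscendenceBasis K b) (e : ι ≃ σ) :
    (Matrix.of fun i j => pderiv (e j) (b i)).det ≠ 0 := by
  classical
  intro hdet
  obtain ⟨v, hv0, hv⟩ := Matrix.exists_mulVec_eq_zero_iff.2 hdet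
  -- A kernel vector `v` of the Jacobian matrix gives a derivation that kills every `b i`. All
  -- variables are algebraic over the algebra generated by `b`, so it kills them too, and its value
  -- at `X (e j)` is `v j`.
  let D : Derivation K (MvPolynomial σ K) (MvPolynomial σ K) := ∑ j, v j • pderiv (e j)
  have hD : ∀ p, D p = ∑ j, v j * pderiv (e j) p := by
    intro p
    change (∑ j, v j • pderiv (e j) : Derivation K (MvPolynomial σ K) (MvPolynomial σ K)) p = _
    rw [← Derivation.coeFnAddMonoidHom_apply, map_sum, Finset.sum_apply]
    simp
  have hDb : ∀ x ∈ Set.range b, D x = 0 := by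
    rintro _ ⟨i, rfl⟩
    rw [hD]
    have := congrFun hv i
    simpa [Matrix.mulVec, dotProduct, mul_comm] using this
  have := hb.isAlgebraic
  apply hv0
  ext1 j
  have h1 : (D.overAdjoin _ hDb) (X (e j)) = 0 :=
    Derivation.eq_zero_of_isAlgebraic _ (Algebra.IsAlgebraic.isAlgebraic _)
  have h2 : D (X (e j)) = 0 := h1
  rw [hD, Finset.sum_eq_single j] at h2
  · simpa using h2
  · intro b _ hb
    rw [pderiv_X_of_ne (by simpa using hb.symm), mul_zero]
  · simp

/-- The transcendence degree equals the number of variables, so the family is a transcendence basis.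
-/
theorem AlgebraicIndependent.det_pderiv_ne_zero [CharZero K] {n : ℕ}
    {b : Fin n → MvPolynomial σ K} (hb : AlgebraicIndependent K b) (e : Fin n ≃ σ) :
    (Matrix.of fun i j => pderiv (e j) (b i)).det ≠ 0 := by
  refine IsTranscendenceBasis.det_pderiv_ne_zero
    (hb.isTranscendenceBasis_of_lift_trdeg_le_of_finite ?_) e
  have := Fintype.ofEquiv _ e
  rw [MvPolynomial.trdeg_of_isDomain, Cardinal.mk_fintype σ, Fintype.card_congr e.symm]
  simp

/-- If `n` polynomials in `n + 1` variables are algebraically independent, then their Jacobian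
matrix has a nonzero maximal minor. -/
theorem AlgebraicIndependent.exists_det_pderiv_ne_zero [CharZero K] {n : ℕ}
    {y : Fin n → MvPolynomial σ K} (hy : AlgebraicIndependent K y) (e : Fin (n + 1) ≃ σ) :
    ∃ j : Fin (n + 1),
      (Matrix.of fun i k => pderiv (e (j.succAbove k)) (y i)).det ≠ 0 := by
  -- The transcendence degree is `n + 1`, so some `z` can be adjoined to `y`. Expanding the
  -- resulting nonzero determinant along the row of `z` yields a nonzero minor of the Jacobian
  -- matrix of `y`.
  obtain ⟨z, hz⟩ : ∃ z, Transcendental (Algebra.adjoin K (Set.range y)) z := by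
    by_contra! hcon
    have halg : Algebra.IsAlgebraic (Algebra.adjoin K (Set.range y)) (MvPolynomial σ K) :=
      ⟨fun x => not_not.1 (hcon x)⟩
    have h1 := hy.isTranscendenceBasis_iff_isAlgebraic.2 halg
    have h2 := h1.lift_cardinalMk_eq_trdeg
    have := Fintype.ofEquiv _ e
    rw [MvPolynomial.trdeg_of_isDomain, Cardinal.mk_fintype σ, Fintype.card_congr e.symm] at h2
    simp only [Cardinal.mk_fin, Cardinal.lift_natCast, Fintype.card_fin, Nat.cast_inj] at h2
    omega
  have hopt := (hy.option_iff_transcendental z).2 hz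
  have hb : AlgebraicIndependent K (Fin.cons z y : Fin (n + 1) → MvPolynomial σ K) := by
    convert! hopt.comp _ (finSuccEquiv n).injective using 1
    ext1 i
    refine Fin.cases ?_ (fun i => ?_) i <;> simp
  have hdet := hb.det_pderiv_ne_zero e
  by_contra! hcon
  apply hdet
  rw [Matrix.det_succ_row_zero]
  refine Finset.sum_eq_zero fun j _ => ?_
  have h3 := hcon j
  have h4 : ((Matrix.of fun i j => pderiv (e j) ((Fin.cons z y : Fin (n + 1) → _) i)).submatrix
      Fin.succ j.succAbove) = Matrix.of fun i k => pderiv (e (j.succAbove k)) (y i) := by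
    ext1 i k
    simp
  rw [h4, h3, mul_zero]

end Jacobian

/-! ### Homogeneous prime ideals and divisibility of forms -/

section HomogeneousIdeals

variable {K : Type*} [Field K] {σ : Type*}

theorem MvPolynomial.exists_homogeneousComponent_ne_zero {g : MvPolynomial σ K} (hg : g ≠ 0) :
    ∃ k ≤ g.totalDegree, homogeneousComponent k g ≠ 0 := by
  by_contra! hcon
  apply hg
  rw [← sum_homogeneousComponent g]
  exact Finset.sum_eq_zero fun k hk => hcon k (by simpa [Nat.lt_succ_iff] using hk)

/-- A nonzero homogeneous prime ideal contains an irreducible form. -/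
theorem Ideal.exists_irreducible_isHomogeneous_mem (P : Ideal (MvPolynomial σ K)) [hP : P.IsPrime]
    (hhom : ∀ g ∈ P, ∀ k, homogeneousComponent k g ∈ P) (hne : P ≠ ⊥) :
    ∃ f ∈ P, Irreducible f ∧ ∃ k, 0 < k ∧ f.IsHomogeneous k := by
  classical
  obtain ⟨g, hgP, hg0⟩ := Submodule.exists_mem_ne_zero_of_ne_bot hne
  have hex : ∃ k, ∃ f ∈ P, f ≠ 0 ∧ f.IsHomogeneous k := by
    obtain ⟨k, -, hk⟩ := exists_homogeneousComponent_ne_zero hg0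
    exact ⟨k, _, hhom g hgP k, hk, homogeneousComponent_isHomogeneous k g⟩
  obtain ⟨f, hfP, hf0, hf⟩ := Nat.find_spec hex
  -- Minimality was imposed on forms only, but it bounds the degree of every nonzero element of `P`,
  -- because `P` contains the homogeneous components. In a factorization of `f` the factor in `P`
  -- thus takes up the whole degree.
  have hmin : ∀ a ∈ P, a ≠ 0 → Nat.find hex ≤ a.totalDegree := by
    intro a haP ha0
    obtain ⟨k, hk, hak⟩ := exists_homogeneousComponent_ne_zero ha0
    exact (Nat.find_min' hex ⟨_, hhom a haP k, hak, homogeneousComponent_isHomogeneous k a⟩).trans hk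
  have hdeg : f.totalDegree = Nat.find hex := hf.totalDegree hf0
  have hunit : ∀ b : MvPolynomial σ K, b ≠ 0 → b.totalDegree = 0 → IsUnit b := by
    intro b hb0 hb
    rw [totalDegree_eq_zero_iff_eq_C.1 hb] at hb0 ⊢
    exact (IsUnit.mk0 _ (by simpa using hb0)).map C
  have hnu : ¬ IsUnit f := fun h => hP.ne_top (Ideal.eq_top_of_isUnit_mem _ hfP h)
  refine ⟨f, hfP, ⟨hnu, ?_⟩, Nat.find hex, ?_, hf⟩
  · intro a b hab
    have hab0 : a * b ≠ 0 := hab ▸ hf0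
    have ha0 := left_ne_zero_of_mul hab0
    have hb0 := right_ne_zero_of_mul hab0
    have hsum : f.totalDegree = a.totalDegree + b.totalDegree := by
      rw [hab, totalDegree_mul_of_isDomain ha0 hb0]
    rcases hP.mem_or_mem (hab ▸ hfP) with h | h
    · have := hmin a h ha0
      exact Or.inr (hunit b hb0 (by omega))
    · have := hmin b h hb0
      exact Or.inl (hunit a ha0 (by omega))
  · rw [← hdeg]
    exact Nat.pos_of_ne_zero fun h => hnu (hunit f hf0 h)

/-- A prime ideal of a polynomial ring that does not meet the polynomials in all but one of the
variables is generated by each of its irreducible elements. -/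
theorem Ideal.dvd_of_mem_of_rename_eq_zero {n : ℕ} (P : Ideal (MvPolynomial (Fin (n + 1)) K))
    [P.IsPrime] (r : Fin n ↪ Fin (n + 1))
    (hr : ∀ G : MvPolynomial (Fin n) K, rename r G ∈ P → G = 0)
    {f : MvPolynomial (Fin (n + 1)) K} (hf : Irreducible f) (hfP : f ∈ P)
    {g : MvPolynomial (Fin (n + 1)) K} (hg : g ∈ P) : f ∣ g := by
  obtain ⟨i, hi⟩ : ∃ i, i ∉ Set.range r := by
    by_contra! hcon
    simpa using Fintype.card_le_of_surjective r hcon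
  have hbij : Function.Bijective (fun o : Option (Fin n) => o.elim i r) := by
    rw [Fintype.bijective_iff_injective_and_card]
    refine ⟨?_, by simp⟩
    rintro (_ | a) (_ | b) hab
    · rfl
    · exact (hi ⟨b, hab.symm⟩).elim
    · exact (hi ⟨a, hab⟩).elim
    · exact congrArg some (r.injective hab)
  let e : Option (Fin n) ≃ Fin (n + 1) := Equiv.ofBijective _ hbij
  have hprime : (Ideal.span {f}).IsPrime := (Ideal.span_singleton_prime hf.ne_zero).2 hf.prime
  have hle : Ideal.span {f} ≤ P := (Ideal.span_singleton_le_iff_mem P).2 hfP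
  let Q := MvPolynomial (Fin (n + 1)) K ⧸ Ideal.span {f}
  let π : MvPolynomial (Fin (n + 1)) K →ₐ[K] Q := Ideal.Quotient.mkₐ K (Ideal.span {f})
  have hπ : ∀ a, π a = 0 ↔ f ∣ a := fun a => by
    rw [← Ideal.mem_span_singleton]
    exact Ideal.Quotient.eq_zero_iff_mem
  let z : Fin (n + 1) → Q := fun j => π (X j)
  have hz : ∀ a, aeval z a = π a := fun a => by
    have : aeval z = π := by
      ext j
      simp [z]
    rw [this]
  have hzr : ∀ G, aeval (z ∘ r) G = π (rename r G) := fun G => by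
    rw [← hz, aeval_rename]
  have hind : AlgebraicIndependent K (z ∘ r) := by
    rw [algebraicIndependent_iff]
    intro G hG
    rw [hzr, hπ] at hG
    exact hr G (P.mem_of_dvd hG hfP)
  -- Otherwise all variables would be independent modulo `f`, although `f` itself is a relation.
  have hzi : IsAlgebraic (Algebra.adjoin K (Set.range (z ∘ r))) (z i) := by
    by_contra hcon
    have h1 := (hind.option_iff_transcendental (z i)).2 hcon
    have h2 : AlgebraicIndependent K z := by
      have h3 : (fun o : Option (Fin n) => o.elim (z i) (z ∘ r)) = z ∘ e := by
        ext1 o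
        rcases o with _ | a <;> rfl
      rw [h3] at h1
      convert! h1.comp e.symm e.symm.injective using 1
      ext1 j
      simp
    exact hf.ne_zero ((algebraicIndependent_iff.1 h2) f (by rw [hz, hπ]))
  have halg : ∀ a, π a ∈ Subalgebra.algebraicClosure (Algebra.adjoin K (Set.range (z ∘ r))) Q := by
    intro a
    induction a using MvPolynomial.induction_on with
    | C c =>
      have : π (C c) = algebraMap (Algebra.adjoin K (Set.range (z ∘ r))) Q (algebraMap K _ c) := by
        rw [← IsScalarTower.algebraMap_apply, ← MvPolynomial.algebraMap_eq, AlgHom.commutes]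
      rw [this]
      exact Subalgebra.algebraMap_mem _ _
    | add p q hp hq => rw [map_add]; exact add_mem hp hq
    | mul_X p j hp =>
      rw [map_mul]
      refine mul_mem hp ?_
      obtain ⟨o, rfl⟩ := e.surjective j
      rcases o with _ | a
      · exact hzi
      · exact isAlgebraic_algebraMap (A := Q)
          (⟨z (r a), Algebra.subset_adjoin ⟨a, rfl⟩⟩ : Algebra.adjoin K (Set.range (z ∘ r)))
  -- The domain `Q` is algebraic over the subalgebra of the variables in the range of `r`. So the
  -- image of `P`, if nonzero, meets that subalgebra nontrivially, which the hypothesis `hr`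
  -- forbids.
  by_contra hgf
  rw [← hπ] at hgf
  have hcomap := Ideal.comap_ne_bot_of_algebraic_mem hgf
    (Ideal.mem_map_of_mem π hg : π g ∈ P.map π) (halg g)
  obtain ⟨s, hs, hs0⟩ := Submodule.exists_mem_ne_zero_of_ne_bot hcomap
  obtain ⟨G, hG⟩ : ∃ G, aeval (z ∘ r) G = (s : Q) := by
    have hmem := s.2
    exact (SetLike.ext_iff.1 (Algebra.adjoin_range_eq_range_aeval K (z ∘ r)) _).1 hmem
  rw [hzr] at hG
  have hs' : π (rename r G) ∈ P.map π := hG ▸ hs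
  obtain ⟨b, hb, hb'⟩ := (Ideal.mem_map_iff_of_surjective π Ideal.Quotient.mk_surjective).1 hs'
  have h3 : rename r G - b ∈ P := by
    refine P.mem_of_dvd ((hπ _).1 ?_) hfP
    rw [map_sub, hb', sub_self]
  have h4 : G = 0 := hr G (by simpa using P.add_mem h3 hb)
  rw [h4, map_zero, map_zero] at hG
  exact hs0 (Subtype.ext hG.symm)

end HomogeneousIdeals

/-- A form evaluated at a multiple of a vector. -/
theorem MvPolynomial.IsHomogeneous.eval_smul_vec {K σ : Type*} [Field K] {f : MvPolynomial σ K}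
    {k : ℕ} (hf : f.IsHomogeneous k) (c : K) (v : σ → K) :
    eval (c • v) f = c ^ k * eval v f := by
  rw [eval_eq, eval_eq, Finset.mul_sum]
  refine Finset.sum_congr rfl fun m hm => ?_
  have hdeg : ∑ i ∈ m.support, m i = k := by
    by_contra hne
    exact mem_support_iff.1 hm (hf.coeff_eq_zero hne)
  simp only [Pi.smul_apply, smul_eq_mul, mul_pow, Finset.prod_mul_distrib, Finset.prod_pow_eq_pow_sum,
    hdeg]
  ring

/-- If a form divides a form, then the cofactor may be taken to be a form. -/
theorem MvPolynomial.IsHomogeneous.exists_eq_mul_isHomogeneous {K σ : Type*} [Field K]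
    {f g : MvPolynomial σ K} {k l : ℕ} (hf : f.IsHomogeneous k) (hg : g.IsHomogeneous l)
    (hg0 : g ≠ 0) (h : f ∣ g) :
    ∃ (m : ℕ) (c : MvPolynomial σ K), c.IsHomogeneous m ∧ k + m = l ∧ g = f * c := by
  obtain ⟨b, hb⟩ := h
  have hcomp : ∀ m, homogeneousComponent l (f * homogeneousComponent m b) =
      if k + m = l then f * homogeneousComponent m b else 0 := fun m => by
    rw [homogeneousComponent_of_mem (hf.mul (homogeneousComponent_isHomogeneous m b))]
    simp only [eq_comm]
  have hsum : g = ∑ m ∈ Finset.range (b.totalDegree + 1),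
      if k + m = l then f * homogeneousComponent m b else 0 := by
    rw [← homogeneousComponent_eq_self hg]
    conv_lhs => rw [hb, ← sum_homogeneousComponent b, Finset.mul_sum, map_sum]
    exact Finset.sum_congr rfl fun m _ => hcomp m
  obtain ⟨m, hm, hne⟩ := Finset.exists_ne_zero_of_sum_ne_zero (hsum ▸ hg0)
  have hkm : k + m = l := by
    by_contra hcon
    exact hne (if_neg hcon)
  refine ⟨m, homogeneousComponent m b, homogeneousComponent_isHomogeneous m b, hkm, ?_⟩
  conv_lhs => rw [hsum]
  rw [Finset.sum_eq_single_of_mem m hm, if_pos hkm]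
  intro m' _ hm'
  exact if_neg (by omega)

/-! ### Closed sets, irreducibility and codimension in projective space -/

namespace PSpace

variable {n : ℕ}

theorem vanishesAt_mk {f : MvPolynomial (Fin (n + 1)) ℂ} (hf : IsForm f) (v : Fin (n + 1) → ℂ)
    (hv : v ≠ 0) : VanishesAt f (Projectivization.mk ℂ v hv) ↔ eval v f = 0 := by
  obtain ⟨k, hk⟩ := hf
  obtain ⟨a, ha⟩ := Projectivization.exists_smul_eq_mk_rep ℂ v hv
  rw [VanishesAt, ← ha, Units.smul_def, hk.eval_smul_vec]
  simp

theorem vanishesAt_mul (f g : MvPolynomial (Fin (n + 1)) ℂ) (p : PSpace n) :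
    VanishesAt (f * g) p ↔ VanishesAt f p ∨ VanishesAt g p := by
  simp [VanishesAt]

theorem IsForm.mul {f g : MvPolynomial (Fin (n + 1)) ℂ} (hf : IsForm f) (hg : IsForm g) :
    IsForm (f * g) := by
  obtain ⟨k, hk⟩ := hf
  obtain ⟨l, hl⟩ := hg
  exact ⟨k + l, hk.mul hl⟩

theorem isClosed_iff {Z : Set (PSpace n)} : IsClosed Z ↔ IsAlgebraicSet Z := by
  rw [← isOpen_compl_iff]
  change Zᶜᶜ ∈ {Z | IsAlgebraicSet (n := n) Z} ↔ _
  rw [compl_compl]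
  rfl

theorem isClosed_zeroLocus {S : Set (MvPolynomial (Fin (n + 1)) ℂ)} (hS : ∀ f ∈ S, IsForm f) :
    IsClosed (zeroLocus S) :=
  isClosed_iff.2 ⟨S, hS, rfl⟩

theorem mem_zeroLocus_singleton {f : MvPolynomial (Fin (n + 1)) ℂ} {p : PSpace n} :
    p ∈ zeroLocus {f} ↔ VanishesAt f p := by
  simp [zeroLocus]

theorem isClosed_zeroLocus_singleton {f : MvPolynomial (Fin (n + 1)) ℂ} (hf : IsForm f) :
    IsClosed (zeroLocus {f}) :=
  isClosed_zeroLocus (by rintro _ rfl; exact hf)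

/-- A closed set is cut out by the forms that vanish on it. -/
theorem mem_of_isClosed {Z : Set (PSpace n)} (hZ : IsClosed Z) {p : PSpace n}
    (h : ∀ f, IsForm f → (∀ q ∈ Z, VanishesAt f q) → VanishesAt f p) : p ∈ Z := by
  obtain ⟨S, hS, rfl⟩ := isClosed_iff.1 hZ
  exact fun f hf => h f (hS f hf) fun q hq => hq f hf

theorem vanishesAt_of_mem_closure {S : Set (PSpace n)} {f : MvPolynomial (Fin (n + 1)) ℂ}
    (hf : IsForm f) (h : ∀ q ∈ S, VanishesAt f q) {p : PSpace n} (hp : p ∈ closure S) :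
    VanishesAt f p := by
  have : closure S ⊆ zeroLocus {f} :=
    closure_minimal (fun q hq => mem_zeroLocus_singleton.2 (h q hq))
      (isClosed_zeroLocus_singleton hf)
  exact mem_zeroLocus_singleton.1 (this hp)

/-- The projective Nullstellensatz for the zero locus of one form. -/
theorem exists_dvd_pow_of_vanishesAt {f g : MvPolynomial (Fin (n + 1)) ℂ} (hf : IsForm f)
    (hg : IsForm g) (hne : (zeroLocus {f}).Nonempty)
    (h : ∀ p ∈ zeroLocus {f}, VanishesAt g p) : ∃ m, f ∣ g ^ m := by
  have hmem : g ∈ vanishingIdeal ℂ (MvPolynomial.zeroLocus ℂ (Ideal.span {f})) := by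
    rw [mem_vanishingIdeal_iff]
    intro x hx
    rw [mem_zeroLocus_iff] at hx
    have hxf := hx f (Ideal.mem_span_singleton_self f)
    rw [aeval_eq_eval] at hxf ⊢
    -- The origin is not a projective point; there `g(0) = 0 ^ k * g(p) = 0` for any zero `p` of
    -- `f`.
    by_cases hx0 : x = 0
    · obtain ⟨p, hp⟩ := hne
      obtain ⟨k, hk⟩ := hg
      have := hk.eval_smul_vec 0 p.rep
      rw [show eval p.rep g = 0 from h p hp, mul_zero, zero_smul] at this
      rw [hx0]
      exact this
    · exact (vanishesAt_mk hg x hx0).1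
        (h _ (mem_zeroLocus_singleton.2 ((vanishesAt_mk hf x hx0).2 hxf)))
  rw [vanishingIdeal_zeroLocus_eq_radical] at hmem
  obtain ⟨m, hm⟩ := hmem
  exact ⟨m, Ideal.mem_span_singleton.1 hm⟩

theorem dvd_of_vanishesAt {f g : MvPolynomial (Fin (n + 1)) ℂ} (hf : IsForm f)
    (hirr : Irreducible f) (hg : IsForm g) (hne : (zeroLocus {f}).Nonempty)
    (h : ∀ p ∈ zeroLocus {f}, VanishesAt g p) : f ∣ g := by
  obtain ⟨m, hm⟩ := exists_dvd_pow_of_vanishesAt hf hg hne h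
  exact hirr.prime.dvd_of_dvd_pow hm

theorem vanishesAt_of_dvd {f g : MvPolynomial (Fin (n + 1)) ℂ} (h : f ∣ g) {p : PSpace n}
    (hp : VanishesAt f p) : VanishesAt g p := by
  obtain ⟨q, rfl⟩ := h
  exact (vanishesAt_mul _ _ _).2 (Or.inl hp)

/-- A form that vanishes everywhere is zero. -/
theorem eq_zero_of_forall_vanishesAt {f : MvPolynomial (Fin (n + 1)) ℂ} (hf : IsForm f)
    (h : ∀ p : PSpace n, VanishesAt f p) : f = 0 := by
  -- The factor `X 0` makes the product vanish at the origin as well.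
  have : f * X 0 = 0 := by
    refine MvPolynomial.funext fun x => ?_
    by_cases hx : x = 0
    · simp [hx]
    · have := (vanishesAt_mk hf x hx).1 (h _)
      simp [this]
  exact (mul_eq_zero.1 this).resolve_right (X_ne_zero 0)

/-- If `Z` is covered by two closed sets and contained in neither, each of them has a form vanishing
on it but not on all of `Z`; the product of the two forms vanishes on `Z`. -/
theorem isIrreducible_of_vanishesAt_mul {Z : Set (PSpace n)} (hne : Z.Nonempty)
    (h : ∀ f g, IsForm f → IsForm g → (∀ p ∈ Z, VanishesAt (f * g) p) →
      (∀ p ∈ Z, VanishesAt f p) ∨ ∀ p ∈ Z, VanishesAt g p) : IsIrreducible Z := by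
  refine ⟨hne, isPreirreducible_iff_isClosed_union_isClosed.2 fun Z₁ Z₂ h₁ h₂ hZ => ?_⟩
  by_contra! hcon
  obtain ⟨⟨p, hpZ, hp⟩, ⟨q, hqZ, hq⟩⟩ := hcon.imp Set.not_subset.1 Set.not_subset.1
  obtain ⟨f, hf, hf₁, hfp⟩ : ∃ f, IsForm f ∧ (∀ q ∈ Z₁, VanishesAt f q) ∧ ¬ VanishesAt f p := by
    by_contra! hcon
    exact hp (mem_of_isClosed h₁ hcon)
  obtain ⟨g, hg, hg₂, hgq⟩ : ∃ f, IsForm f ∧ (∀ q ∈ Z₂, VanishesAt f q) ∧ ¬ VanishesAt f q := by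
    by_contra! hcon
    exact hq (mem_of_isClosed h₂ hcon)
  rcases h f g hf hg fun x hx => (vanishesAt_mul _ _ _).2 ((hZ hx).imp (hf₁ x) (hg₂ x)) with h | h
  · exact hfp (h p hpZ)
  · exact hgq (h q hqZ)

theorem isIrreducible_zeroLocus_singleton {f : MvPolynomial (Fin (n + 1)) ℂ} (hf : IsForm f)
    (hirr : Irreducible f) (hne : (zeroLocus {f}).Nonempty) : IsIrreducible (zeroLocus {f}) := by
  refine isIrreducible_of_vanishesAt_mul hne fun g h hg hh hgh => ?_
  refine (hirr.prime.dvd_or_dvd (dvd_of_vanishesAt hf hirr (hg.mul hh) hne hgh)).imp ?_ ?_ <;>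
  exact fun hdvd p hp => vanishesAt_of_dvd hdvd (mem_zeroLocus_singleton.1 hp)

/-- The zero locus of an irreducible form, as an irreducible closed set. -/
def irreducibleZeroLocus {f : MvPolynomial (Fin (n + 1)) ℂ} (hf : IsForm f)
    (hirr : Irreducible f) (hne : (zeroLocus {f}).Nonempty) :
    TopologicalSpace.IrreducibleCloseds (PSpace n) :=
  ⟨zeroLocus {f}, isIrreducible_zeroLocus_singleton hf hirr hne, isClosed_zeroLocus_singleton hf⟩

/-- A closed irreducible set that properly contains the zero locus of an irreducible form is the
whole projective space. -/
theorem eq_univ_of_zeroLocus_ssubset {f : MvPolynomial (Fin (n + 1)) ℂ} (hf : IsForm f)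
    (hirr : Irreducible f) (hne : (zeroLocus {f}).Nonempty) {Y : Set (PSpace n)}
    (hY : IsIrreducible Y) (hYc : IsClosed Y) (hfY : zeroLocus {f} ⊂ Y) : Y = Set.univ := by
  obtain ⟨k, hk⟩ := hf
  have hk0 : k ≠ 0 := by
    rintro rfl
    have h1 := (totalDegree_zero_iff_isHomogeneous _).2 hk
    rw [totalDegree_eq_zero_iff_eq_C] at h1
    apply hirr.not_isUnit
    have h2 := hirr.ne_zero
    rw [h1] at h2 ⊢
    exact (IsUnit.mk0 _ (by simpa using h2)).map C
  -- Descent on the degree: a nonzero form `g` vanishing on `Y` is `f * c`, and since `Y` is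
  -- irreducible and not inside the zero locus of `f`, the form `c` of smaller degree vanishes on
  -- `Y`.
  have key : ∀ l : ℕ, ∀ g : MvPolynomial (Fin (n + 1)) ℂ, g.IsHomogeneous l →
      (∀ p ∈ Y, VanishesAt g p) → g = 0 := by
    intro l
    induction l using Nat.strong_induction_on with
    | _ l ih =>
      intro g hg hgY
      by_contra hg0
      obtain ⟨b, hb⟩ := dvd_of_vanishesAt ⟨k, hk⟩ hirr ⟨l, hg⟩ hne fun p hp => hgY p (hfY.1 hp)
      obtain ⟨m, c, hc, hlm, hgc⟩ := hk.exists_eq_mul_isHomogeneous hg hg0 ⟨b, hb⟩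
      have hYfc : Y ⊆ zeroLocus {f} ∪ zeroLocus {c} := by
        intro p hp
        rw [Set.mem_union, mem_zeroLocus_singleton, mem_zeroLocus_singleton, ← vanishesAt_mul,
          ← hgc]
        exact hgY p hp
      rcases isPreirreducible_iff_isClosed_union_isClosed.1 hY.isPreirreducible _ _
        (isClosed_zeroLocus_singleton ⟨k, hk⟩) (isClosed_zeroLocus_singleton ⟨m, hc⟩) hYfc with h | h
      · exact hfY.2 h
      · refine hg0 ?_
        rw [hgc, ih m (by omega) c hc fun p hp => mem_zeroLocus_singleton.1 (h hp), mul_zero]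
  refine Set.eq_univ_of_forall fun p => mem_of_isClosed hYc fun g ⟨l, hg⟩ hgY => ?_
  rw [key l g hg hgY]
  simp [VanishesAt]

/-- Every irreducible closed set strictly above the zero locus is the whole space, so the zero locus
has coheight at most one. -/
theorem codim_zeroLocus_le_one {f : MvPolynomial (Fin (n + 1)) ℂ} (hf : IsForm f)
    (hirr : Irreducible f) (hne : (zeroLocus {f}).Nonempty) : codim (zeroLocus {f}) ≤ 1 := by
  have hle : codim (zeroLocus {f}) ≤ Order.coheight (irreducibleZeroLocus hf hirr hne) :=
    iInf₂_le (f := fun (Y : TopologicalSpace.IrreducibleCloseds (PSpace n))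
      (_ : (Y : Set (PSpace n)) ⊆ zeroLocus {f}) => Order.coheight Y)
      (irreducibleZeroLocus hf hirr hne) (Set.Subset.refl (zeroLocus {f}))
  refine hle.trans ?_
  rw [← Nat.cast_one, Order.coheight_le_coe_iff]
  intro Y hY
  have hYu : (Y : Set (PSpace n)) = Set.univ :=
    eq_univ_of_zeroLocus_ssubset hf hirr hne Y.isIrreducible Y.isClosed hY
  have hmax : IsMax Y := by
    intro Z _ p _
    change p ∈ (Y : Set (PSpace n))
    rw [hYu]
    trivial
  rw [Order.coheight_eq_zero.2 hmax]
  exact Nat.cast_lt.2 Nat.one_pos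

/-- The chain from `D` through the zero locus of `f` to the whole space has length two, and
irreducible closed subsets of `D` have coheight at least that of `D`. -/
theorem one_lt_codim_of_ssubset_zeroLocus {f : MvPolynomial (Fin (n + 1)) ℂ} (hf : IsForm f)
    (hirr : Irreducible f) {D : Set (PSpace n)} (hD : IsIrreducible D) (hDc : IsClosed D)
    (hDf : D ⊂ zeroLocus {f}) : 1 < codim D := by
  have hne : (zeroLocus {f}).Nonempty := hD.nonempty.mono hDf.1
  let Y₀ : TopologicalSpace.IrreducibleCloseds (PSpace n) := ⟨D, hD, hDc⟩
  have h1 : Y₀ < irreducibleZeroLocus hf hirr hne := hDf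
  have h2 : ¬ IsMax (irreducibleZeroLocus hf hirr hne) := by
    intro hmax
    have huniv : IsIrreducible (Set.univ : Set (PSpace n)) := by
      refine isIrreducible_of_vanishesAt_mul (hne.mono (Set.subset_univ _)) fun g h hg hh hgh => ?_
      refine (mul_eq_zero.1 (eq_zero_of_forall_vanishesAt (hg.mul hh) fun p => hgh p trivial)).imp
        ?_ ?_ <;>
      · rintro rfl p -
        simp [VanishesAt]
    have := hmax (b := ⟨Set.univ, huniv, isClosed_univ⟩) (Set.subset_univ _)
    exact hirr.ne_zero (eq_zero_of_forall_vanishesAt hf fun p =>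
      mem_zeroLocus_singleton.1 (this (Set.mem_univ p)))
  have h3 : (1 : ℕ∞) + 1 ≤ Order.coheight Y₀ :=
    (add_le_add_left (Order.one_le_iff_pos.2 (Order.coheight_pos.2 h2)) 1).trans
      (Order.coheight_add_one_le h1)
  have h4 : (1 : ℕ∞) + 1 ≤ codim D :=
    le_iInf₂ fun Y hY => h3.trans (Order.coheight_anti (show Y ≤ Y₀ from hY))
  refine lt_of_lt_of_le ?_ h4
  exact_mod_cast Nat.lt_succ_self 1

end PSpace

/-! ### Closures of images of polynomial maps -/

section Parametrization

variable {K σ ι : Type*} [Field K]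

theorem MvPolynomial.eval_aeval (y : ι → MvPolynomial σ K) (s : σ → K) (g : MvPolynomial ι K) :
    eval s (aeval y g) = eval (fun j => eval s (y j)) g := by
  rw [← coe_aeval_eq_eval, ← coe_aeval_eq_eval]
  change ((aeval s).comp (aeval y)) g = _
  rw [comp_aeval]
  simp

/-- Substituting forms of the same positive degree respects homogeneous components. -/
theorem MvPolynomial.aeval_homogeneousComponent {y : ι → MvPolynomial σ K} {e : ℕ} (he : 0 < e)
    (hy : ∀ i, (y i).IsHomogeneous e) (g : MvPolynomial ι K) (k : ℕ) :
    aeval y (homogeneousComponent k g) = homogeneousComponent (e * k) (aeval y g) := by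
  have hcomp : ∀ m, homogeneousComponent (e * k) (aeval y (homogeneousComponent m g)) =
      if m = k then aeval y (homogeneousComponent m g) else 0 := fun m => by
    rw [homogeneousComponent_of_mem ((homogeneousComponent_isHomogeneous m g).aeval y hy)]
    simp only [Nat.mul_left_cancel_iff he, eq_comm]
  conv_rhs => rw [← sum_homogeneousComponent g, map_sum, map_sum]
  simp only [hcomp, Finset.sum_ite_eq', Finset.mem_range]
  split_ifs with hk
  · rfl
  · rw [homogeneousComponent_eq_zero _ _ (by omega), map_zero]

end Parametrization

namespace PSpace

variable {n : ℕ} {σ : Type*}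

/-- The closure of the image of the map given by polynomials `y`, as the zero locus of the forms
that vanish on that image. -/
def imageClosure (y : Fin (n + 1) → MvPolynomial σ ℂ) : Set (PSpace n) :=
  zeroLocus {g | IsForm g ∧ aeval y g = 0}

theorem isClosed_imageClosure (y : Fin (n + 1) → MvPolynomial σ ℂ) : IsClosed (imageClosure y) :=
  isClosed_zeroLocus fun _ h => h.1

theorem mk_mem_imageClosure (y : Fin (n + 1) → MvPolynomial σ ℂ) (s : σ → ℂ)
    (hs : (fun j => eval s (y j)) ≠ 0) : Projectivization.mk ℂ _ hs ∈ imageClosure y := by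
  rintro g ⟨hg, hyg⟩
  rw [vanishesAt_mk hg, ← eval_aeval, hyg, map_zero]

theorem forall_vanishesAt_imageClosure_iff {y : Fin (n + 1) → MvPolynomial σ ℂ} (hy : y ≠ 0)
    {g : MvPolynomial (Fin (n + 1)) ℂ} (hg : IsForm g) :
    (∀ p ∈ imageClosure y, VanishesAt g p) ↔ aeval y g = 0 := by
  refine ⟨fun h => ?_, fun h p hp => hp g ⟨hg, h⟩⟩
  obtain ⟨i, hi⟩ := Function.ne_iff.1 hy
  -- Where all `y j` vanish there is no image point; the factor `y i` disposes of these parameters.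
  have : aeval y g * y i = 0 := by
    refine MvPolynomial.funext fun s => ?_
    by_cases hs : (fun j => eval s (y j)) = 0
    · rw [map_mul, show eval s (y i) = 0 from congrFun hs i, mul_zero, map_zero]
    · rw [map_mul, eval_aeval, (vanishesAt_mk hg _ hs).1 (h _ (mk_mem_imageClosure y s hs)),
        zero_mul, map_zero]
  exact (mul_eq_zero.1 this).resolve_right hi

theorem imageClosure_nonempty {y : Fin (n + 1) → MvPolynomial σ ℂ} (hy : y ≠ 0) :
    (imageClosure y).Nonempty := by
  obtain ⟨i, hi⟩ := Function.ne_iff.1 hy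
  obtain ⟨s, hs⟩ : ∃ s, eval s (y i) ≠ 0 := by
    by_contra! hcon
    exact hi (MvPolynomial.funext fun s => by simpa using hcon s)
  exact ⟨_, mk_mem_imageClosure y s fun h => hs (congrFun h i)⟩

theorem isIrreducible_imageClosure {y : Fin (n + 1) → MvPolynomial σ ℂ} (hy : y ≠ 0) :
    IsIrreducible (imageClosure y) := by
  refine isIrreducible_of_vanishesAt_mul (imageClosure_nonempty hy) fun f g hf hg h => ?_
  rw [forall_vanishesAt_imageClosure_iff hy (hf.mul hg), map_mul, mul_eq_zero] at h
  rwa [forall_vanishesAt_imageClosure_iff hy hf, forall_vanishesAt_imageClosure_iff hy hg]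

/-- If the image closure of a map given by forms of the same degree is the zero locus of a form,
then all but one of these forms are algebraically independent. -/
theorem exists_algebraicIndependent_of_imageClosure_eq {y : Fin (n + 1) → MvPolynomial σ ℂ}
    (hy0 : y ≠ 0) {e : ℕ} (he : 0 < e) (hy : ∀ i, (y i).IsHomogeneous e) {k : ℕ}
    {f : MvPolynomial (Fin (n + 1)) ℂ} (hk : 0 < k) (hf0 : f ≠ 0) (hf : f.IsHomogeneous k)
    (h : imageClosure y = zeroLocus {f}) :
    ∃ r : Fin n ↪ Fin (n + 1), AlgebraicIndependent ℂ (y ∘ r) := by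
  obtain ⟨i, hi⟩ : ∃ i, f.degreeOf i ≠ 0 := by
    by_contra! hcon
    have h1 : f.totalDegree ≤ 0 := by
      refine (totalDegree_le_degrees_card f).trans ?_
      rw [Nat.le_zero, Multiset.card_eq_zero, Multiset.eq_zero_iff_forall_notMem]
      intro i hi
      rw [← Multiset.count_pos, ← degreeOf_def, hcon i] at hi
      exact lt_irrefl _ hi
    rw [hf.totalDegree hf0] at h1
    omega
  refine ⟨⟨i.succAbove, Fin.succAbove_right_injective⟩, ?_⟩
  -- A homogeneous relation among the forms other than `y i` vanishes on the zero locus of `f`, so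
  -- `f` divides a power of it. This is impossible for a nonzero relation, since `X i` occurs in `f`
  -- but not in the relation.
  have key : ∀ (l : ℕ) (G : MvPolynomial (Fin n) ℂ), G.IsHomogeneous l →
      aeval (y ∘ i.succAbove) G = 0 → G = 0 := by
    intro l G hG hyG
    rw [← aeval_rename, ← forall_vanishesAt_imageClosure_iff hy0 ⟨l, hG.rename_isHomogeneous⟩, h]
      at hyG
    obtain ⟨m, hm⟩ := exists_dvd_pow_of_vanishesAt ⟨k, hf⟩ ⟨l, hG.rename_isHomogeneous⟩
      (h ▸ imageClosure_nonempty hy0) hyG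
    by_contra hG0
    obtain ⟨b, hb⟩ := hm
    have hne : (rename i.succAbove G) ^ m ≠ 0 :=
      pow_ne_zero _ ((map_ne_zero_iff _ (rename_injective _ Fin.succAbove_right_injective)).2 hG0)
    have hdeg : degreeOf i ((rename i.succAbove G) ^ m) = 0 := by
      have hG' : degreeOf i (rename i.succAbove G) = 0 := by
        classical
        rw [degreeOf_def, Multiset.count_eq_zero, degrees_rename_of_injective
          Fin.succAbove_right_injective]
        simp [Fin.succAbove_ne]
      have := degreeOf_pow_le i (rename i.succAbove G) m
      rw [hG'] at this
      omega
    rw [hb] at hne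
    rw [hb, degreeOf_mul_eq (left_ne_zero_of_mul hne) (right_ne_zero_of_mul hne)] at hdeg
    omega
  rw [algebraicIndependent_iff]
  intro G hG
  by_contra hG0
  obtain ⟨l, -, hl⟩ := exists_homogeneousComponent_ne_zero hG0
  refine hl (key l _ (homogeneousComponent_isHomogeneous l G) ?_)
  change aeval (y ∘ i.succAbove) G = 0 at hG
  rw [aeval_homogeneousComponent (y := y ∘ i.succAbove) he (fun j => hy _), hG, map_zero]

/-- The image closure of a map given by algebraically dependent forms of the same degree lies in
the zero locus of an irreducible form, with equality if all but one of them are independent. -/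
theorem exists_irreducible_imageClosure_subset {y : Fin (n + 1) → MvPolynomial σ ℂ}
    {e : ℕ} (he : 0 < e) (hy : ∀ i, (y i).IsHomogeneous e) (hdep : ¬ AlgebraicIndependent ℂ y) :
    ∃ (k : ℕ) (f : MvPolynomial (Fin (n + 1)) ℂ), 0 < k ∧ Irreducible f ∧ f.IsHomogeneous k ∧
      imageClosure y ⊆ zeroLocus {f} ∧
      ((∃ r : Fin n ↪ Fin (n + 1), AlgebraicIndependent ℂ (y ∘ r)) →
        imageClosure y = zeroLocus {f}) := by
  -- The ideal of relations is prime, stable under homogeneous components because all `y i` have the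
  -- same positive degree, and nonzero by dependence. If `n` of the forms are independent, every
  -- relation is a multiple of `f`.
  let P : Ideal (MvPolynomial (Fin (n + 1)) ℂ) := RingHom.ker (aeval y : _ →ₐ[ℂ] MvPolynomial σ ℂ)
  have hP : P.IsPrime := RingHom.ker_isPrime _
  obtain ⟨f, hfP, hirr, k, hk, hf⟩ := P.exists_irreducible_isHomogeneous_mem
    (fun g hg k => by
      rw [RingHom.mem_ker] at hg ⊢
      rw [aeval_homogeneousComponent he hy, hg, map_zero])
    (fun hbot => hdep ((RingHom.injective_iff_ker_eq_bot _).2 hbot))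
  have hsub : imageClosure y ⊆ zeroLocus {f} := fun p hp =>
    mem_zeroLocus_singleton.2 (hp f ⟨⟨k, hf⟩, hfP⟩)
  refine ⟨k, f, hk, hirr, hf, hsub, fun ⟨r, hr⟩ => hsub.antisymm fun p hp g hg => ?_⟩
  refine vanishesAt_of_dvd ?_ (mem_zeroLocus_singleton.1 hp)
  refine P.dvd_of_mem_of_rename_eq_zero r (fun G hG => ?_) hirr hfP hg.2
  rw [RingHom.mem_ker, aeval_rename] at hG
  exact (algebraicIndependent_iff.1 hr) G hG

theorem isHypersurface_imageClosure_iff {y : Fin (n + 1) → MvPolynomial σ ℂ} (hy0 : y ≠ 0)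
    {e : ℕ} (he : 0 < e) (hy : ∀ i, (y i).IsHomogeneous e) (hdep : ¬ AlgebraicIndependent ℂ y) :
    IsHypersurface (imageClosure y) ↔
      ∃ r : Fin n ↪ Fin (n + 1), AlgebraicIndependent ℂ (y ∘ r) := by
  constructor
  · rintro ⟨k, f, hk, hf0, hf, h⟩
    exact exists_algebraicIndependent_of_imageClosure_eq hy0 he hy hk hf0 hf h
  · intro h
    obtain ⟨k, f, hk, hirr, hf, -, heq⟩ := exists_irreducible_imageClosure_subset he hy hdep
    exact ⟨k, f, hk, hirr.ne_zero, hf, heq h⟩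

/-- The image closure either equals the zero locus of an irreducible form or is strictly contained
in it; the two codimension bounds separate these cases. -/
theorem one_lt_codim_imageClosure_iff {y : Fin (n + 1) → MvPolynomial σ ℂ} (hy0 : y ≠ 0)
    {e : ℕ} (he : 0 < e) (hy : ∀ i, (y i).IsHomogeneous e) (hdep : ¬ AlgebraicIndependent ℂ y) :
    1 < codim (imageClosure y) ↔ ¬ IsHypersurface (imageClosure y) := by
  obtain ⟨k, f, hk, hirr, hf, hsub, heq⟩ := exists_irreducible_imageClosure_subset he hy hdep
  constructor
  · intro h hhyp
    rw [heq ((isHypersurface_imageClosure_iff hy0 he hy hdep).1 hhyp)] at h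
    exact absurd h (not_lt.2 (codim_zeroLocus_le_one ⟨k, hf⟩ hirr
      ((imageClosure_nonempty hy0).mono hsub)))
  · intro h
    refine one_lt_codim_of_ssubset_zeroLocus ⟨k, hf⟩ hirr (isIrreducible_imageClosure hy0)
      (isClosed_imageClosure y) (hsub.ssubset_of_ne fun heq => ?_)
    exact h ⟨k, f, hk, hirr.ne_zero, hf, heq⟩

end PSpace

/-! ### Tangent spaces and their semicontinuity -/

/-- A subspace of `Kⁿ` is its own double orthogonal complement. -/
theorem Submodule.mem_iff_forall_dotProduct_eq_zero {K ι : Type*} [Field K] [Fintype ι]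
    (W : Submodule K (ι → K)) (x : ι → K) :
    x ∈ W ↔ ∀ v : ι → K, (∀ w ∈ W, v ⬝ᵥ w = 0) → v ⬝ᵥ x = 0 := by
  classical
  refine ⟨fun hx v hv => hv x hx, fun h => ?_⟩
  by_contra hx
  obtain ⟨φ, hφx, hφ⟩ := W.exists_le_ker_of_notMem hx
  have hdot : ∀ w, (fun i => φ (Pi.single i 1)) ⬝ᵥ w = φ w := fun w => by
    conv_rhs => rw [pi_eq_sum_univ' w, map_sum]
    refine Finset.sum_congr rfl fun i _ => ?_
    rw [map_smul, smul_eq_mul, mul_comm]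
  exact hφx (by rw [← hdot]; exact h _ fun w hw => by rw [hdot]; exact hφ hw)

theorem MvPolynomial.isHomogeneous_det {K σ ι : Type*} [Field K] [Fintype ι] [DecidableEq ι]
    {M : Matrix ι ι (MvPolynomial σ K)} {k : ι → ℕ} (hM : ∀ i j, (M i j).IsHomogeneous (k i)) :
    M.det.IsHomogeneous (∑ i, k i) := by
  rw [Matrix.det_apply]
  refine IsHomogeneous.sum _ _ _ fun τ _ => ?_
  have h := IsHomogeneous.prod Finset.univ (fun i => M (τ i) i) (fun i => k (τ i))
    fun i _ => hM (τ i) i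
  rw [Equiv.sum_comp τ k] at h
  rcases Int.units_eq_one_or (Equiv.Perm.sign τ) with hs | hs
  · rwa [hs, one_smul]
  · rw [hs, Units.neg_smul, one_smul]
    exact h.neg

/-- The chain rule for a polynomial along a curve. -/
theorem MvPolynomial.hasDerivAt_eval {ι : Type*} [Fintype ι] {y : ℂ → ι → ℂ} {w : ι → ℂ} {s : ℂ}
    (hy : ∀ i, HasDerivAt (fun s => y s i) (w i) s) (f : MvPolynomial ι ℂ) :
    HasDerivAt (fun s => eval (y s) f) (∑ i, eval (y s) (pderiv i f) * w i) s := by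
  classical
  induction f using MvPolynomial.induction_on with
  | C a => simpa using hasDerivAt_const s a
  | add p q hp hq =>
    simp only [map_add, add_mul, Finset.sum_add_distrib]
    exact hp.add hq
  | mul_X p j hp =>
    convert! hp.mul (hy j) using 1
    · ext1 s
      simp
    · simp only [Derivation.leibniz, pderiv_X, smul_eq_mul, map_add, map_mul, eval_X, add_mul,
        Finset.sum_add_distrib, Finset.sum_mul]
      rw [add_comm]
      congr 1
      · exact Finset.sum_congr rfl fun i _ => by ring
      · rw [Finset.sum_eq_single j]
        · simp
        · intro b _ hb
          simp [hb.symm]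
        · simp

namespace PSpace

variable {n : ℕ}

/-- The gradients at `p ∈ X` of the forms that vanish on `X`. -/
def gradientSpace (X : Set (PSpace n)) {p : PSpace n} (hp : p ∈ X) :
    Submodule ℂ (Fin (n + 1) → ℂ) where
  carrier := {g | ∃ (k : ℕ) (f : MvPolynomial (Fin (n + 1)) ℂ), f.IsHomogeneous k ∧
    (∀ q ∈ X, VanishesAt f q) ∧ g = fun j => eval p.rep (pderiv j f)}
  zero_mem' := ⟨0, 0, isHomogeneous_zero _ _ _, fun q _ => by simp [VanishesAt], by
    ext1 j
    simp⟩
  add_mem' := by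
    rintro _ _ ⟨k, f, hf, hfX, rfl⟩ ⟨l, g, hg, hgX, rfl⟩
    obtain ⟨i, hi⟩ := Function.ne_iff.1 p.rep_nonzero
    -- Forms of different degrees do not add up to a form. Multiplying by powers of a linear form
    -- with value `1` at `p` equalizes the degrees and keeps the gradient at `p`, because the forms
    -- vanish there.
    let ℓ : MvPolynomial (Fin (n + 1)) ℂ := C (p.rep i)⁻¹ * MvPolynomial.X i
    have hℓ : ℓ.IsHomogeneous 1 := isHomogeneous_C_mul_X _ _
    have hℓp : eval p.rep ℓ = 1 := by
      simp only [ℓ, map_mul, eval_C, eval_X]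
      exact inv_mul_cancel₀ hi
    have hgrad : ∀ (m : ℕ) (h : MvPolynomial (Fin (n + 1)) ℂ), VanishesAt h p → ∀ j,
        eval p.rep (pderiv j (ℓ ^ m * h)) = eval p.rep (pderiv j h) := by
      intro m h hh j
      rw [pderiv_mul, map_add, map_mul, map_mul, show eval p.rep h = 0 from hh, map_pow (eval p.rep), hℓp]
      simp
    refine ⟨l + k, ℓ ^ l * f + ℓ ^ k * g, ?_, fun q hq => ?_, ?_⟩
    · have h1 := (hℓ.pow l).mul hf
      have h2 := (hℓ.pow k).mul hg
      rw [one_mul] at h1 h2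
      rw [add_comm k l] at h2
      exact h1.add h2
    · have h1 : eval q.rep f = 0 := hfX q hq
      have h2 : eval q.rep g = 0 := hgX q hq
      simp [VanishesAt, h1, h2]
    · ext1 j
      rw [map_add, map_add, hgrad _ _ (hfX p hp), hgrad _ _ (hgX p hp)]
      rfl
  smul_mem' := by
    rintro c _ ⟨k, f, hf, hfX, rfl⟩
    refine ⟨k, C c * f, hf.C_mul c, fun q hq => ?_, ?_⟩
    · have h1 : eval q.rep f = 0 := hfX q hq
      simp [VanishesAt, h1]
    · ext1 j
      simp

theorem mem_tangentSpace_iff {X : Set (PSpace n)} {p : PSpace n} (hp : p ∈ X)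
    {w : Fin (n + 1) → ℂ} : w ∈ tangentSpace X p ↔ ∀ g ∈ gradientSpace X hp, g ⬝ᵥ w = 0 := by
  constructor
  · rintro h _ ⟨k, f, hf, hfX, rfl⟩
    exact h f ⟨k, hf⟩ hfX
  · rintro h f ⟨k, hf⟩ hfX
    exact h _ ⟨k, f, hf, hfX, rfl⟩

theorem mem_gradientSpace_iff {X : Set (PSpace n)} {p : PSpace n} (hp : p ∈ X)
    {g : Fin (n + 1) → ℂ} : g ∈ gradientSpace X hp ↔ ∀ w ∈ tangentSpace X p, g ⬝ᵥ w = 0 := by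
  rw [Submodule.mem_iff_forall_dotProduct_eq_zero]
  simp only [mem_tangentSpace_iff hp, dotProduct_comm]

/-- Semicontinuity: the dimension of the tangent space at a point of a closure is attained as an
upper bound at some point of the set. -/
theorem exists_finrank_tangentSpace_le {S : Set (PSpace n)} {q : PSpace n} (hq : q ∈ closure S) :
    ∃ p ∈ S, Module.finrank ℂ (tangentSpace (closure S) p) ≤
      Module.finrank ℂ (tangentSpace (closure S) q) := by
  let m := Module.finrank ℂ (gradientSpace (closure S) hq)
  let b := Module.finBasis ℂ (gradientSpace (closure S) hq)
  have hb : ∀ i, ∃ (k : ℕ) (f : MvPolynomial (Fin (n + 1)) ℂ), f.IsHomogeneous k ∧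
    (∀ q ∈ closure S, VanishesAt f q) ∧
      ((b i : gradientSpace (closure S) hq) : Fin (n + 1) → ℂ) =
        fun j => eval q.rep (pderiv j f) := fun i => (b i).2
  choose k f hf hfX hbf using hb
  let M : PSpace n → Matrix (Fin m) (Fin (n + 1)) ℂ :=
    fun p => Matrix.of fun i j => eval p.rep (pderiv j (f i))
  have hrank : (M q).rank = m := by
    have hli : LinearIndependent ℂ (M q).row := by
      convert! b.linearIndependent.map' _ (gradientSpace (closure S) hq).ker_subtype using 1
      ext1 i
      exact (hbf i).symm
    simpa using hli.rank_matrix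
  have hker : ∀ p, (M p).rank = m → Module.finrank ℂ (LinearMap.ker (M p).mulVecLin) + m = n + 1 :=
    fun p hp => by
      have := (M p).mulVecLin.finrank_range_add_finrank_ker
      rw [Module.finrank_fin_fun, ← Matrix.rank, hp] at this
      omega
  have hTq : tangentSpace (closure S) q = LinearMap.ker (M q).mulVecLin := by
    ext w
    rw [mem_tangentSpace_iff hq, LinearMap.mem_ker]
    constructor
    · intro h
      ext i
      have := h _ (b i).2
      rw [hbf] at this
      exact this
    · intro h g hg
      have hg' := b.sum_repr ⟨g, hg⟩
      have hg'' := congrArg Subtype.val hg'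
      rw [← show _ = g from hg'']
      simp only [Submodule.coe_sum, Submodule.coe_smul, sum_dotProduct, smul_dotProduct]
      refine Finset.sum_eq_zero fun i _ => ?_
      have h2 := congrFun h i
      rw [hbf]
      exact (congrArg _ h2).trans (smul_zero _)
  obtain ⟨W, hW⟩ : ∃ W : Matrix (Fin (n + 1)) (Fin m) ℂ, M q * W = 1 := by
    refine Matrix.mulVec_surjective_iff_exists_right_inverse.1 ?_
    have htop : LinearMap.range (M q).mulVecLin = ⊤ := Submodule.eq_top_of_finrank_eq ?_
    · exact LinearMap.range_eq_top.1 htop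
    rw [← Matrix.rank, hrank, Module.finrank_fin_fun]
  -- The rows of `M q` are a basis of the gradient space at `q`, and `W` is a right inverse of `M
  -- q`. The form `Δ` takes the value `det (M p * W)` at `p`, which is `1` at `q`, so it cannot
  -- vanish on all of `S`. Where it is nonzero, `M p` has full rank `m` and the tangent space is at
  -- most as large as at `q`.
  let Δ : MvPolynomial (Fin (n + 1)) ℂ :=
    (Matrix.of fun i j => ∑ l, pderiv l (f i) * C (W l j)).det
  have hΔ : IsForm Δ := by
    refine ⟨_, isHomogeneous_det (k := fun i => k i - 1) fun i j => ?_⟩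
    rw [Matrix.of_apply]
    refine IsHomogeneous.sum _ _ _ fun l _ => ?_
    have h := (hf i).pderiv (i := l) |>.mul (isHomogeneous_C (Fin (n + 1)) (W l j))
    rwa [add_zero] at h
  have hΔp : ∀ p : PSpace n, eval p.rep Δ = (M p * W).det := by
    intro p
    rw [RingHom.map_det]
    congr 1
    ext i j
    simp [M, Matrix.mul_apply]
  obtain ⟨p, hp, hpΔ⟩ : ∃ p ∈ S, ¬ VanishesAt Δ p := by
    by_contra! hcon
    have := vanishesAt_of_mem_closure hΔ hcon hq
    rw [VanishesAt, hΔp, hW, Matrix.det_one] at this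
    exact one_ne_zero this
  have hMp : (M p).rank = m := by
    refine le_antisymm (by simpa using (M p).rank_le_card_height) ?_
    rw [VanishesAt, hΔp] at hpΔ
    have h1 := Matrix.rank_of_det_ne_zero hpΔ
    rw [Fintype.card_fin] at h1
    exact h1.symm.le.trans (Matrix.rank_mul_le_left _ _)
  refine ⟨p, hp, ?_⟩
  have hTp : tangentSpace (closure S) p ≤ LinearMap.ker (M p).mulVecLin := by
    intro w hw
    rw [LinearMap.mem_ker]
    ext i
    exact hw (f i) ⟨k i, hf i⟩ (hfX i)
  have h1 := Submodule.finrank_mono hTp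
  have h2 := hker p hMp
  have h3 := hker q hrank
  rw [hTq]
  omega

end PSpace

/-! ### Tangent spaces of the reciprocal linear space -/

namespace PSpace

variable {n : ℕ} {L : Submodule ℂ (Fin (n + 1) → ℂ)}

/-- The points with nonzero coordinates whose coordinatewise inverse lies in `L`. -/
def reciprocalTorus (L : Submodule ℂ (Fin (n + 1) → ℂ)) : Set (PSpace n) :=
  {p | (∀ i, p.rep i ≠ 0) ∧ (fun i => (p.rep i)⁻¹) ∈ L}

theorem mk_mem_reciprocalTorus {y : Fin (n + 1) → ℂ} (h : y ≠ 0) (hy : ∀ i, y i ≠ 0)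
    (hyL : (fun i => (y i)⁻¹) ∈ L) : Projectivization.mk ℂ y h ∈ reciprocalTorus L := by
  obtain ⟨a, ha⟩ := Projectivization.exists_smul_eq_mk_rep ℂ y h
  have hrep : ∀ i, (Projectivization.mk ℂ y h).rep i = (a : ℂ) * y i := fun i => by
    rw [← ha]
    rfl
  refine ⟨fun i => ?_, ?_⟩
  · rw [hrep]
    exact mul_ne_zero a.ne_zero (hy i)
  · convert! L.smul_mem (a : ℂ)⁻¹ hyL using 1
    ext1 i
    rw [hrep, mul_inv]
    rfl

theorem reciprocal_eq_closure (L : Submodule ℂ (Fin (n + 1) → ℂ)) :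
    reciprocal L = closure (reciprocalTorus L) := by
  refine congrArg closure (Set.ext fun p => ⟨?_, fun hp => ?_⟩)
  · rintro ⟨x, hx, hx0, h, rfl⟩
    exact mk_mem_reciprocalTorus h (fun i => inv_ne_zero (hx0 i)) (by simpa using hx)
  · refine ⟨_, hp.2, fun i => inv_ne_zero (hp.1 i), ?_, ?_⟩
    · simpa using p.rep_nonzero
    · simp

theorem reciprocalTorus_subset : reciprocalTorus L ⊆ reciprocal L := by
  rw [reciprocal_eq_closure]
  exact subset_closure

/-- The tangent space of a reciprocal linear space at a point of the torus contains the expected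
space. -/
theorem mem_tangentSpace_reciprocal {p : PSpace n} (hp : p ∈ reciprocalTorus L)
    {u : Fin (n + 1) → ℂ} (hu : u ∈ L) :
    (fun i => p.rep i ^ 2 * u i) ∈ tangentSpace (reciprocal L) p := by
  obtain ⟨hp0, hpL⟩ := hp
  intro f hf hfX
  -- A curve on the cone over `L⁻¹`, inverse to a line in `L`, whose velocity at `0` is `p² u`.
  let c : ℂ → Fin (n + 1) → ℂ := fun s i => ((p.rep i)⁻¹ - s * u i)⁻¹
  have hc0 : c 0 = p.rep := by
    ext1 i
    simp [c]
  have hc : ∀ i, HasDerivAt (fun s => c s i) (p.rep i ^ 2 * u i) 0 := by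
    intro i
    have h1 : HasDerivAt (fun s : ℂ => (p.rep i)⁻¹ - s * u i) (-u i) 0 := by
      simpa using ((hasDerivAt_id (0 : ℂ)).mul_const (u i)).const_sub (p.rep i)⁻¹
    have h2 := h1.inv (by simpa using hp0 i)
    convert! h2 using 1
    simp
    ring
  have hev : ∀ᶠ s in nhds (0 : ℂ), eval (c s) f = 0 := by
    have h1 : ∀ i, ∀ᶠ s in nhds (0 : ℂ), (p.rep i)⁻¹ - s * u i ≠ 0 := fun i => by
      have hcont : Continuous fun s : ℂ => (p.rep i)⁻¹ - s * u i := by fun_prop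
      exact hcont.continuousAt.eventually_ne (by simpa using hp0 i)
    filter_upwards [Filter.eventually_all.2 h1] with s hs
    have hcs : ∀ i, c s i ≠ 0 := fun i => inv_ne_zero (hs i)
    have hne : c s ≠ 0 := fun h => hcs 0 (congrFun h 0)
    refine (vanishesAt_mk hf (c s) hne).1 (hfX _ (reciprocalTorus_subset
      (mk_mem_reciprocalTorus hne hcs ?_)))
    convert! L.sub_mem hpL (L.smul_mem s hu) using 1
    ext1 i
    simp [c]
  have h1 := hasDerivAt_eval hc f
  have h2 : HasDerivAt (fun s => eval (c s) f) 0 0 :=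
    (hasDerivAt_const (0 : ℂ) (0 : ℂ)).congr_of_eventuallyEq hev
  rw [hc0] at h1
  exact h1.unique h2

/-- The form obtained from `∑ vᵢ / yᵢ` by clearing denominators. -/
def reciprocalForm (v : Fin (n + 1) → ℂ) : MvPolynomial (Fin (n + 1)) ℂ :=
  ∑ i, C (v i) * ∏ j ∈ Finset.univ.erase i, X j

theorem isForm_reciprocalForm (v : Fin (n + 1) → ℂ) : IsForm (reciprocalForm v) := by
  refine ⟨n, IsHomogeneous.sum _ _ _ fun i _ => IsHomogeneous.C_mul ?_ _⟩
  have := IsHomogeneous.prod (Finset.univ.erase i)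
    (fun j => (X j : MvPolynomial (Fin (n + 1)) ℂ)) (fun _ => 1) fun j _ => isHomogeneous_X _ j
  simpa using this

theorem eval_reciprocalForm (v : Fin (n + 1) → ℂ) {y : Fin (n + 1) → ℂ} (hy : ∀ i, y i ≠ 0) :
    eval y (reciprocalForm v) = (∏ i, y i) * ∑ i, v i * (y i)⁻¹ := by
  simp only [reciprocalForm, map_sum, map_mul, map_prod, eval_C, eval_X, Finset.mul_sum]
  refine Finset.sum_congr rfl fun i _ => ?_
  rw [← Finset.mul_prod_erase Finset.univ y (Finset.mem_univ i)]
  field_simp [hy i]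

/-- For `v` orthogonal to `L`, the form `(∏ yⱼ) ∑ vᵢ / yᵢ` vanishes on `L⁻¹`. Its derivative at `p`
along `w` is `-(∏ pⱼ) ∑ vᵢ wᵢ / pᵢ²`, as the sum itself vanishes at `p`. So `w / p²` is orthogonal
to every such `v`, hence lies in `L`. -/
theorem mem_tangentSpace_reciprocal_iff {p : PSpace n} (hp : p ∈ reciprocalTorus L)
    {w : Fin (n + 1) → ℂ} :
    w ∈ tangentSpace (reciprocal L) p ↔ (fun i => w i * ((p.rep i)⁻¹) ^ 2) ∈ L := by
  have hp0 := hp.1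
  constructor
  · intro hw
    rw [Submodule.mem_iff_forall_dotProduct_eq_zero]
    intro v hv
    have hvan : ∀ q ∈ reciprocal L, VanishesAt (reciprocalForm v) q := by
      intro q hq
      rw [reciprocal_eq_closure] at hq
      refine vanishesAt_of_mem_closure (isForm_reciprocalForm v) (fun q hq => ?_) hq
      rw [VanishesAt, eval_reciprocalForm v hq.1]
      exact mul_eq_zero_of_right _ (hv _ hq.2)
    have hpv : ∑ i, v i * (p.rep i)⁻¹ = 0 := hv _ hp.2
    let c : ℂ → Fin (n + 1) → ℂ := fun s i => p.rep i + s * w i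
    have hc0 : c 0 = p.rep := by
      ext1 i
      simp [c]
    have hc : ∀ i, HasDerivAt (fun s => c s i) (w i) 0 := fun i => by
      have h := ((hasDerivAt_id (0 : ℂ)).mul_const (w i)).const_add (p.rep i)
      rw [one_mul] at h
      exact h
    have h1 := hasDerivAt_eval hc (reciprocalForm v)
    rw [hc0, hw _ (isForm_reciprocalForm v) hvan] at h1
    have hprod : DifferentiableAt ℂ (fun s => ∏ i, c s i) 0 := by
      simp only [c]
      fun_prop
    have hsum : HasDerivAt (fun s => ∑ i, v i * (c s i)⁻¹)
        (∑ i, v i * (-w i / (c 0 i) ^ 2)) 0 :=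
      HasDerivAt.fun_sum fun i _ => ((hc i).fun_inv (by rw [hc0]; exact hp0 i)).const_mul (v i)
    have h2 := hprod.hasDerivAt.fun_mul hsum
    have hev : (fun s => eval (c s) (reciprocalForm v)) =ᶠ[nhds 0]
        fun s => (∏ i, c s i) * ∑ i, v i * (c s i)⁻¹ := by
      have h3 : ∀ i, ∀ᶠ s in nhds (0 : ℂ), c s i ≠ 0 := fun i =>
        (hc i).continuousAt.eventually_ne (by simpa [c] using hp0 i)
      filter_upwards [Filter.eventually_all.2 h3] with s hs
      exact eval_reciprocalForm v hs
    have h4 := h1.unique (h2.congr_of_eventuallyEq hev)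
    simp only [hc0] at h4
    rw [hpv, mul_zero, zero_add] at h4
    have h5 := (mul_eq_zero.1 h4.symm).resolve_left (Finset.prod_ne_zero_iff.2 fun i _ => hp0 i)
    rw [← neg_eq_zero, ← h5, dotProduct, ← Finset.sum_neg_distrib]
    refine Finset.sum_congr rfl fun i _ => ?_
    rw [div_eq_mul_inv, inv_pow]
    ring
  · intro hw
    convert! mem_tangentSpace_reciprocal hp hw using 1
    ext1 i
    field_simp [hp0 i]

theorem finrank_tangentSpace_reciprocal {p : PSpace n} (hp : p ∈ reciprocalTorus L) :
    Module.finrank ℂ (tangentSpace (reciprocal L) p) = Module.finrank ℂ L := by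
  let e : (Fin (n + 1) → ℂ) ≃ₗ[ℂ] (Fin (n + 1) → ℂ) := LinearEquiv.piCongrRight fun i =>
    LinearEquiv.smulOfNeZero ℂ ℂ (((p.rep i)⁻¹) ^ 2) (pow_ne_zero _ (inv_ne_zero (hp.1 i)))
  have h : tangentSpace (reciprocal L) p = L.comap (e : (Fin (n + 1) → ℂ) →ₗ[ℂ] _) := by
    ext w
    rw [mem_tangentSpace_reciprocal_iff hp, Submodule.mem_comap]
    have : (fun i => w i * ((p.rep i)⁻¹) ^ 2) = e w := by
      ext1 i
      exact mul_comm _ _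
    rw [this]
    rfl
  rw [h, ← LinearEquiv.finrank_map_eq e, Submodule.map_comap_eq_of_surjective e.surjective]

/-- All torus points have a tangent space of dimension `dim L`, and by semicontinuity no point of
the closure has a smaller one. -/
theorem reciprocalTorus_subset_regularPoints :
    reciprocalTorus L ⊆ regularPoints (reciprocal L) := by
  refine fun p hp => ⟨reciprocalTorus_subset hp, fun q hq => ?_⟩
  rw [reciprocal_eq_closure] at hq
  obtain ⟨p', hp', hle⟩ := exists_finrank_tangentSpace_le hq
  rw [← reciprocal_eq_closure, finrank_tangentSpace_reciprocal hp'] at hle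
  rwa [finrank_tangentSpace_reciprocal hp]

/-! ### The parametrization of the dual variety -/

section DualVariety

variable {d m : ℕ} (A : Matrix (Fin (d + 1)) (Fin (n + 1)) ℂ) (B : Matrix (Fin (n + 1)) (Fin m) ℂ)

/-- The coordinate functions `x = Aᵀ t` of the linear space, as polynomials. -/
def spaceCoord (i : Fin (n + 1)) : MvPolynomial (Fin (d + 1) ⊕ Fin m) ℂ :=
  ∑ k, C (A k i) * X (Sum.inl k)

/-- The coordinate functions `v = B u` of the orthogonal space, as polynomials. -/
def orthCoord (i : Fin (n + 1)) : MvPolynomial (Fin (d + 1) ⊕ Fin m) ℂ :=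
  ∑ k, C (B i k) * X (Sum.inr k)

/-- The parametrization `(t, u) ↦ (Aᵀ t)² (B u)` of the dual variety. -/
def dualParam (i : Fin (n + 1)) : MvPolynomial (Fin (d + 1) ⊕ Fin m) ℂ :=
  spaceCoord A i ^ 2 * orthCoord B i

theorem eval_spaceCoord (s : Fin (d + 1) ⊕ Fin m → ℂ) (i : Fin (n + 1)) :
    eval s (spaceCoord (m := m) A i) = A.transpose.mulVec (s ∘ Sum.inl) i := by
  simp [spaceCoord, Matrix.mulVec, dotProduct]

theorem eval_orthCoord (s : Fin (d + 1) ⊕ Fin m → ℂ) (i : Fin (n + 1)) :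
    eval s (orthCoord (d := d) B i) = B.mulVec (s ∘ Sum.inr) i := by
  simp [orthCoord, Matrix.mulVec, dotProduct]

theorem isHomogeneous_dualParam (i : Fin (n + 1)) : (dualParam A B i).IsHomogeneous 3 := by
  have h1 : (spaceCoord (m := m) A i).IsHomogeneous 1 :=
    IsHomogeneous.sum _ _ _ fun k _ => isHomogeneous_C_mul_X _ _
  have h2 : (orthCoord (d := d) B i).IsHomogeneous 1 :=
    IsHomogeneous.sum _ _ _ fun k _ => isHomogeneous_C_mul_X _ _
  exact (h1.pow 2).mul h2

variable {A B}

theorem mem_iff_exists_transpose_mulVec (hA : Submodule.span ℂ (Set.range A.row) = L)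
    {x : Fin (n + 1) → ℂ} : x ∈ L ↔ ∃ t, A.transpose.mulVec t = x := by
  rw [← hA, ← Matrix.col_transpose, ← Matrix.range_mulVecLin]
  rfl

theorem orthogonal_iff_exists_mulVec (hA : Submodule.span ℂ (Set.range A.row) = L)
    (hBspan : Submodule.span ℂ (Set.range B.col) = LinearMap.ker A.mulVecLin)
    {v : Fin (n + 1) → ℂ} : (∀ x ∈ L, v ⬝ᵥ x = 0) ↔ ∃ u, B.mulVec u = v := by
  have h1 : (∃ u, B.mulVec u = v) ↔ v ∈ LinearMap.ker A.mulVecLin := by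
    rw [← hBspan, ← Matrix.range_mulVecLin]
    rfl
  rw [h1, LinearMap.mem_ker]
  constructor
  · intro h
    ext i
    rw [Matrix.mulVecLin_apply, Matrix.mulVec, dotProduct_comm]
    exact h _ (hA ▸ Submodule.subset_span ⟨i, rfl⟩)
  · intro h x hx
    obtain ⟨t, rfl⟩ := (mem_iff_exists_transpose_mulVec hA).1 hx
    rw [Matrix.dotProduct_mulVec, Matrix.vecMul_transpose]
    rw [Matrix.mulVecLin_apply] at h
    rw [h, zero_dotProduct]

theorem spaceCoord_ne_zero (hA : Submodule.span ℂ (Set.range A.row) = L)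
    (hcoord : ∀ i, ∃ x ∈ L, x i ≠ 0) (i : Fin (n + 1)) : spaceCoord (m := m) A i ≠ 0 := by
  obtain ⟨x, hx, hxi⟩ := hcoord i
  obtain ⟨t, rfl⟩ := (mem_iff_exists_transpose_mulVec hA).1 hx
  intro h
  have := eval_spaceCoord A (Sum.elim t (0 : Fin m → ℂ)) i
  rw [h, map_zero, Sum.elim_comp_inl] at this
  exact hxi this.symm

theorem dualParam_ne_zero (hA : Submodule.span ℂ (Set.range A.row) = L)
    (hcoord : ∀ i, ∃ x ∈ L, x i ≠ 0) (hB : B ≠ 0) : dualParam A B ≠ 0 := by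
  obtain ⟨i, j, hij⟩ : ∃ i j, B i j ≠ 0 := by
    by_contra! hcon
    exact hB (by ext i j; exact hcon i j)
  intro h
  have h1 := (mul_eq_zero.1 (congrFun h i)).resolve_left
    (pow_ne_zero _ (spaceCoord_ne_zero hA hcoord i))
  have := eval_orthCoord (d := d) B (Sum.elim 0 (Pi.single j 1)) i
  rw [h1, map_zero, Sum.elim_comp_inr] at this
  simp at this
  exact hij this.symm

/-- At a point of the torus, a gradient of a form vanishing on the reciprocal linear space is a
value of the parametrization. -/
theorem exists_eval_dualParam_eq (hA : Submodule.span ℂ (Set.range A.row) = L)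
    (hBspan : Submodule.span ℂ (Set.range B.col) = LinearMap.ker A.mulVecLin)
    {p : PSpace n} (hp : p ∈ reciprocalTorus L) {z : Fin (n + 1) → ℂ}
    (hz : ∀ w ∈ tangentSpace (reciprocal L) p, z ⬝ᵥ w = 0) :
    ∃ s, (fun i => eval s (dualParam A B i)) = z := by
  obtain ⟨t, ht⟩ := (mem_iff_exists_transpose_mulVec hA).1 hp.2
  -- As `z` annihilates `p² L`, the vector `p² z` is orthogonal to `L` and equals `B u`. With `Aᵀ t
  -- = 1/p` this gives `z = (Aᵀ t)² (B u)`.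
  obtain ⟨u, hu⟩ := (orthogonal_iff_exists_mulVec (v := fun i => z i * p.rep i ^ 2) hA hBspan).1
    fun x hx => by
      rw [← hz _ (mem_tangentSpace_reciprocal hp hx)]
      exact Finset.sum_congr rfl fun i _ => by ring
  refine ⟨Sum.elim t u, ?_⟩
  ext1 i
  rw [dualParam, map_mul, map_pow, eval_spaceCoord, eval_orthCoord, Sum.elim_comp_inl,
    Sum.elim_comp_inr, ht, hu]
  have := hp.1 i
  field_simp

/-- Regular points outside the torus need no separate description: a conormal vector at any point is
the gradient of a form `F` vanishing on `L⁻¹`, and the gradients of `F` at torus points are values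
of the parametrization. A form `g` vanishing on these values gives a form `g(∇F)` that vanishes on
the torus points and hence on their closure. Conversely, a generic value of the parametrization is
tangent at a torus point. -/
theorem dualVariety_reciprocal_eq (hA : Submodule.span ℂ (Set.range A.row) = L)
    (hBspan : Submodule.span ℂ (Set.range B.col) = LinearMap.ker A.mulVecLin)
    (hcoord : ∀ i, ∃ x ∈ L, x i ≠ 0) (hB : B ≠ 0) :
    dualVariety (reciprocal L) = imageClosure (dualParam A B) := by
  refine Set.Subset.antisymm (closure_minimal ?_ (isClosed_imageClosure _)) ?_
  · rintro _ ⟨⟨p, z⟩, ⟨hp, hz⟩, rfl⟩ g ⟨⟨l, hg⟩, hgy⟩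
    have hpX : p ∈ reciprocal L := hp.1
    obtain ⟨k, F, hF, hFX, hFz⟩ := (mem_gradientSpace_iff hpX).2 hz
    have hH : IsForm (aeval (fun j => pderiv j F) g) :=
      ⟨_, hg.aeval _ fun j => hF.pderiv⟩
    have hpH : VanishesAt (aeval (fun j => pderiv j F) g) p := by
      rw [reciprocal_eq_closure] at hpX
      refine vanishesAt_of_mem_closure hH (fun q hq => ?_) hpX
      rw [VanishesAt, eval_aeval]
      obtain ⟨s, hs⟩ := exists_eval_dualParam_eq hA hBspan hq
        (z := fun j => eval q.rep (pderiv j F)) fun w hw => hw F ⟨k, hF⟩ hFX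
      rw [← hs, ← eval_aeval, hgy, map_zero]
    rw [VanishesAt, eval_aeval, ← hFz] at hpH
    exact hpH
  · intro z hz
    refine mem_of_isClosed isClosed_closure fun g hg hgD => hz g ⟨hg, ?_⟩
    obtain ⟨i₀, hi₀⟩ := Function.ne_iff.1 (dualParam_ne_zero (m := m) hA hcoord hB)
    -- The extra factors vanish at the parameters for which `1/x` or the image point is undefined,
    -- so only generic parameters remain.
    have hzero : aeval (dualParam A B) g * ((∏ i, spaceCoord A i) * dualParam A B i₀) = 0 := by
      refine MvPolynomial.funext fun s => ?_
      by_cases hs : (∀ i, eval s (spaceCoord (m := m) A i) ≠ 0) ∧ eval s (dualParam A B i₀) ≠ 0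
      · obtain ⟨hs1, hs2⟩ := hs
        have hz0 : (fun i => eval s (dualParam A B i)) ≠ 0 := fun h => hs2 (congrFun h i₀)
        have hy0 : (fun i => (eval s (spaceCoord (m := m) A i))⁻¹) ≠ 0 := fun h =>
          inv_ne_zero (hs1 0) (congrFun h 0)
        have hp : Projectivization.mk ℂ _ hy0 ∈ reciprocalTorus L := by
          refine mk_mem_reciprocalTorus hy0 (fun i => inv_ne_zero (hs1 i)) ?_
          simp only [inv_inv, eval_spaceCoord]
          exact (mem_iff_exists_transpose_mulVec hA).2 ⟨_, rfl⟩
        have hmem : Projectivization.mk ℂ _ hz0 ∈ dualVariety (reciprocal L) := by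
          refine subset_closure ⟨⟨Projectivization.mk ℂ _ hy0, _⟩,
            ⟨reciprocalTorus_subset_regularPoints hp, fun w hw => ?_⟩, rfl⟩
          obtain ⟨a, ha⟩ := Projectivization.exists_smul_eq_mk_rep ℂ _ hy0
          obtain ⟨b, hb⟩ := Projectivization.exists_smul_eq_mk_rep ℂ _ hz0
          rw [mem_tangentSpace_reciprocal_iff hp, ← ha] at hw
          have horth := (orthogonal_iff_exists_mulVec hA hBspan).2 ⟨s ∘ Sum.inr, rfl⟩ _ hw
          change ∑ i, (Projectivization.mk ℂ _ hz0).rep i * w i = 0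
          rw [← hb]
          have hcalc : ∑ i, (b • fun i => eval s (dualParam A B i)) i * w i =
              (b : ℂ) * (a : ℂ) ^ 2 * (B.mulVec (s ∘ Sum.inr) ⬝ᵥ fun i =>
                w i * ((a • fun i => (eval s (spaceCoord (m := m) A i))⁻¹) i)⁻¹ ^ 2) := by
            rw [dotProduct, Finset.mul_sum]
            refine Finset.sum_congr rfl fun i _ => ?_
            simp only [Pi.smul_apply, Units.smul_def, smul_eq_mul, dualParam, map_mul, map_pow,
              eval_orthCoord]
            have := hs1 i
            have := a.ne_zero
            field_simp
          rw [hcalc, horth, mul_zero]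
        have := (vanishesAt_mk hg _ hz0).1 (hgD _ hmem)
        rw [map_mul, eval_aeval, this, zero_mul, map_zero]
      · rw [not_and_or, not_forall] at hs
        have : eval s ((∏ i, spaceCoord (m := m) A i) * dualParam A B i₀) = 0 := by
          rw [map_mul, map_prod]
          rcases hs with ⟨i, hi⟩ | hs
          · rw [Finset.prod_eq_zero (Finset.mem_univ i) (not_not.1 hi), zero_mul]
          · rw [not_not.1 hs, mul_zero]
        rw [map_mul, this, mul_zero, map_zero]
    exact (mul_eq_zero.1 hzero).resolve_right (mul_ne_zero
      (Finset.prod_ne_zero_iff.2 fun i _ => spaceCoord_ne_zero hA hcoord i) hi₀)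

end DualVariety

end PSpace

/-! ### Minors and ranks of the Jacobian matrix -/

/-- A family spanning a space of dimension `n` contains `n` linearly independent vectors. -/
theorem exists_embedding_linearIndependent {K V ι : Type*} [Field K] [AddCommGroup V] [Module K V]
    [Finite ι] (v : ι → V) {n : ℕ} (hn : Module.finrank K (Submodule.span K (Set.range v)) = n) :
    ∃ r : Fin n ↪ ι, LinearIndependent K (v ∘ r) := by
  obtain ⟨κ, a, ha, hspan, hli⟩ := exists_linearIndependent' K v
  have := Finite.of_injective a ha
  have := Fintype.ofFinite κ
  have hcard : Fintype.card κ = n := by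
    rw [← finrank_span_eq_card hli, hspan, hn]
  let e := (Fintype.equivFinOfCardEq hcard).symm
  exact ⟨e.toEmbedding.trans ⟨a, ha⟩, hli.comp e e.injective⟩

/-- A matrix of rank `n` has a nonzero minor of size `n`. -/
theorem Matrix.exists_det_submatrix_ne_zero {K m k : Type*} [Field K] [Fintype m] [Fintype k]
    (M : Matrix m k K) {n : ℕ} (hM : M.rank = n) :
    ∃ (r : Fin n ↪ m) (c : Fin n ↪ k), (M.submatrix r c).det ≠ 0 := by
  obtain ⟨r, hr⟩ := exists_embedding_linearIndependent M.row (by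
    rw [← Matrix.rank_eq_finrank_span_row, hM])
  have h1 : (M.submatrix r id).rank = n := by
    have : LinearIndependent K (M.submatrix r id).row := hr
    simpa using this.rank_matrix
  obtain ⟨c, hc⟩ := exists_embedding_linearIndependent (M.submatrix r id).col (by
    rw [← Matrix.rank_eq_finrank_span_cols, h1])
  refine ⟨r, c, ?_⟩
  have h2 : LinearIndependent K (M.submatrix r c).col := hc
  have h3 := Matrix.linearIndependent_cols_iff_isUnit.1 h2
  exact ((Matrix.isUnit_iff_isUnit_det _).1 h3).ne_zero

namespace PSpace

section Jacobian

variable {R : Type*} [CommRing R] {n d m : ℕ} (A : Matrix (Fin (d + 1)) (Fin (n + 1)) R)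
  (B : Matrix (Fin (n + 1)) (Fin m) R) (t : Fin (d + 1) → R) (u : Fin m → R)

theorem jacobian_inl (i : Fin (n + 1)) (k : Fin (d + 1)) :
    jacobian A B t u i (Sum.inl k) = B.mulVec u i * A k i := by
  simp [jacobian, Matrix.diagonal_mul]

theorem jacobian_inr (i : Fin (n + 1)) (k : Fin m) :
    jacobian A B t u i (Sum.inr k) = A.transpose.mulVec t i * B i k := by
  simp [jacobian, Matrix.diagonal_mul]

/-- Both blocks produce the coordinatewise product of `Aᵀ t` and `B u`. This reflects that `(t, u) ↦
(Aᵀ t)² (B u)` is invariant under `(λ t, λ⁻² u)`. -/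
theorem jacobian_mulVec : (jacobian A B t u).mulVec (Sum.elim t (-u)) = 0 := by
  ext i
  simp only [Matrix.mulVec, dotProduct, Fintype.sum_sum_type, jacobian_inl, jacobian_inr,
    Sum.elim_inl, Sum.elim_inr, Pi.neg_apply, Pi.zero_apply, Matrix.transpose_apply, mul_neg,
    Finset.sum_neg_distrib]
  rw [← sub_eq_add_neg, sub_eq_zero]
  simp only [mul_assoc, ← Finset.mul_sum]
  rw [mul_comm]

/-- Rescaling representatives only rescales columns, so the rank is well defined on the product of
projective spaces. -/
theorem jacobian_smul (a b : R) : jacobian A B (a • t) (b • u) =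
    jacobian A B t u * (Matrix.diagonal (Sum.elim (fun _ => b) (fun _ => a)) :
      Matrix (Fin (d + 1) ⊕ Fin m) (Fin (d + 1) ⊕ Fin m) R) := by
  ext i (k | k)
  · simp only [Matrix.mul_diagonal, jacobian_inl, Matrix.mulVec_smul, Pi.smul_apply, smul_eq_mul,
      Sum.elim_inl]
    ring
  · simp only [Matrix.mul_diagonal, jacobian_inr, Matrix.mulVec_smul, Pi.smul_apply, smul_eq_mul,
      Sum.elim_inr]
    ring

end Jacobian

variable {n d m : ℕ} (A : Matrix (Fin (d + 1)) (Fin (n + 1)) ℂ) (B : Matrix (Fin (n + 1)) (Fin m) ℂ)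

theorem map_eval_genericJacobian (s : Fin (d + 1) ⊕ Fin m → ℂ) :
    (genericJacobian A B).map (eval s) = jacobian A B (s ∘ Sum.inl) (s ∘ Sum.inr) := by
  ext i (k | k)
  · simp [genericJacobian, jacobian_inl, Matrix.mulVec, dotProduct]
  · simp [genericJacobian, jacobian_inr, Matrix.mulVec, dotProduct]

theorem eval_det_genericJacobian {k : ℕ} (r : Fin k → Fin (n + 1)) (c : Fin k → Fin (d + 1) ⊕ Fin m)
    (s : Fin (d + 1) ⊕ Fin m → ℂ) : eval s ((genericJacobian A B).submatrix r c).det =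
      ((jacobian A B (s ∘ Sum.inl) (s ∘ Sum.inr)).submatrix r c).det := by
  rw [RingHom.map_det, ← map_eval_genericJacobian]
  rfl

/-- The partial derivatives of the parametrization of the dual variety are the entries of the
matrix `genericJacobian`, up to nonzero factors for the rows and the columns. -/
theorem pderiv_dualParam (i : Fin (n + 1)) (c : Fin (d + 1) ⊕ Fin m) :
    pderiv c (dualParam A B i) =
      spaceCoord A i * (Sum.elim (fun _ => 2) (fun _ => 1) c * genericJacobian A B i c) := by
  have hx : ∀ c, pderiv c (spaceCoord (m := m) A i) = Sum.elim (fun k => C (A k i)) (fun _ => 0) c := by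
    rintro (k | k)
    · simp [spaceCoord, Pi.single_apply]
    · simp [spaceCoord]
  have hv : ∀ c, pderiv c (orthCoord (d := d) B i) = Sum.elim (fun _ => 0) (fun k => C (B i k)) c := by
    rintro (k | k)
    · simp [orthCoord]
    · simp [orthCoord, Pi.single_apply]
  rw [dualParam, pderiv_mul, pderiv_pow, hx, hv]
  rcases c with k | k
  · have : genericJacobian A B i (Sum.inl k) = orthCoord B i * C (A k i) := by
      simp [genericJacobian, jacobian_inl, Matrix.mulVec, dotProduct, orthCoord]
    rw [this]
    simp
    ring
  · have : genericJacobian A B i (Sum.inr k) = spaceCoord A i * C (B i k) := by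
      simp [genericJacobian, jacobian_inr, Matrix.mulVec, dotProduct, spaceCoord]
    rw [this]
    simp
    ring

theorem det_pderiv_dualParam_eq_zero_iff {A : Matrix (Fin (d + 1)) (Fin (n + 1)) ℂ}
    {B : Matrix (Fin (n + 1)) (Fin m) ℂ} (hA : ∀ i, spaceCoord (m := m) A i ≠ 0)
    {k : ℕ} (r : Fin k → Fin (n + 1)) (c : Fin k → Fin (d + 1) ⊕ Fin m) :
    (Matrix.of fun i j => pderiv (c j) (dualParam A B (r i))).det = 0 ↔
      ((genericJacobian A B).submatrix r c).det = 0 := by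
  have h : (Matrix.of fun i j => pderiv (c j) (dualParam A B (r i))) =
      Matrix.of fun i j => spaceCoord A (r i) * (Matrix.of fun i j =>
        (Sum.elim (fun _ => 2) (fun _ => 1) (c j) : MvPolynomial (Fin (d + 1) ⊕ Fin m) ℂ) *
          (genericJacobian A B).submatrix r c i j) i j := by
    ext1 i j
    exact pderiv_dualParam A B (r i) (c j)
  rw [h, Matrix.det_mul_column, Matrix.det_mul_row, mul_eq_zero, mul_eq_zero,
    or_iff_right (Finset.prod_ne_zero_iff.2 fun i _ => hA (r i)), or_iff_right]
  refine Finset.prod_ne_zero_iff.2 fun j _ => ?_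
  rcases c j with k | k <;> simp

/-- The square matrix `genericJacobian A B` kills the nonzero vector `(t, -u)`, so its determinant
is zero, which contradicts independence by the Jacobian criterion. -/
theorem not_algebraicIndependent_dualParam {A : Matrix (Fin (d + 1)) (Fin (n + 1)) ℂ}
    {B : Matrix (Fin (n + 1)) (Fin m) ℂ} (hA : ∀ i, spaceCoord (m := m) A i ≠ 0)
    (e : Fin (n + 1) ≃ Fin (d + 1) ⊕ Fin m) : ¬ AlgebraicIndependent ℂ (dualParam A B) := by
  intro h
  refine h.det_pderiv_ne_zero e ((det_pderiv_dualParam_eq_zero_iff hA id e).2 ?_)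
  rw [← Matrix.exists_mulVec_eq_zero_iff]
  have h1 := jacobian_mulVec (A.map MvPolynomial.C) (B.map MvPolynomial.C)
    (fun i => (X (Sum.inl i) : MvPolynomial (Fin (d + 1) ⊕ Fin m) ℂ)) (fun j => X (Sum.inr j))
  refine ⟨Sum.elim (fun i => X (Sum.inl i)) (-fun j => X (Sum.inr j)) ∘ e, ?_,
    (Matrix.submatrix_mulVec_equiv (genericJacobian A B) _ id e).trans ?_⟩
  · intro h2
    have h3 := congrFun h2 (e.symm (Sum.inl 0))
    simp at h3
  · rw [Function.comp_assoc, Equiv.self_comp_symm, Function.comp_id]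
    exact congrArg (· ∘ id) h1

theorem exists_algebraicIndependent_dualParam_iff {A : Matrix (Fin (d + 1)) (Fin (n + 1)) ℂ}
    {B : Matrix (Fin (n + 1)) (Fin m) ℂ} (hA : ∀ i, spaceCoord (m := m) A i ≠ 0)
    (e : Fin (n + 1) ≃ Fin (d + 1) ⊕ Fin m) :
    (∃ r : Fin n ↪ Fin (n + 1), AlgebraicIndependent ℂ (dualParam A B ∘ r)) ↔
      ∃ (r : Fin n ↪ Fin (n + 1)) (c : Fin n ↪ Fin (d + 1) ⊕ Fin m),
        ((genericJacobian A B).submatrix r c).det ≠ 0 := by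
  refine exists_congr fun r => ⟨fun h => ?_, fun ⟨c, hc⟩ => ?_⟩
  · obtain ⟨j, hj⟩ := h.exists_det_pderiv_ne_zero e
    let c : Fin n ↪ Fin (d + 1) ⊕ Fin m :=
      ⟨fun k => e (j.succAbove k), e.injective.comp Fin.succAbove_right_injective⟩
    exact ⟨c, fun h0 => hj ((det_pderiv_dualParam_eq_zero_iff hA r c).2 h0)⟩
  · exact AlgebraicIndependent.of_det_pderiv_ne_zero _ c
      fun h0 => hc ((det_pderiv_dualParam_eq_zero_iff hA r c).1 h0)

theorem rank_jacobian_le {t : Fin (d + 1) → ℂ} (u : Fin m → ℂ) (ht : t ≠ 0)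
    (hm : d + 1 + m = n + 1) : (jacobian A B t u).rank ≤ n := by
  have h1 := (jacobian A B t u).mulVecLin.finrank_range_add_finrank_ker
  rw [← Matrix.rank, Module.finrank_fintype_fun_eq_card, Fintype.card_sum, Fintype.card_fin,
    Fintype.card_fin, hm] at h1
  have h2 : 0 < Module.finrank ℂ (LinearMap.ker (jacobian A B t u).mulVecLin) := by
    rw [Module.finrank_pos_iff, Submodule.nontrivial_iff_ne_bot, Submodule.ne_bot_iff]
    refine ⟨Sum.elim t (-u), jacobian_mulVec A B t u, fun h => ht ?_⟩
    ext k
    exact congrFun h (Sum.inl k)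
  omega

theorem exists_rank_jacobian_eq_iff (hm : d + 1 + m = n + 1) (hm0 : 0 < m) :
    (∃ (t : ℙ ℂ (Fin (d + 1) → ℂ)) (u : ℙ ℂ (Fin m → ℂ)), (jacobian A B t.rep u.rep).rank = n) ↔
      ∃ (r : Fin n ↪ Fin (n + 1)) (c : Fin n ↪ Fin (d + 1) ⊕ Fin m),
        ((genericJacobian A B).submatrix r c).det ≠ 0 := by
  constructor
  · rintro ⟨t, u, h⟩
    obtain ⟨r, c, hrc⟩ := Matrix.exists_det_submatrix_ne_zero _ h
    refine ⟨r, c, fun h0 => hrc ?_⟩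
    have := eval_det_genericJacobian A B r c (Sum.elim t.rep u.rep)
    rwa [h0, map_zero, Sum.elim_comp_inl, Sum.elim_comp_inr, eq_comm] at this
  · rintro ⟨r, c, h⟩
    -- The factors `t₀` and `u₀` ensure that both parts of `s` are nonzero and define projective
    -- points.
    obtain ⟨s, hs⟩ : ∃ s, eval s (((genericJacobian A B).submatrix r c).det *
        (X (Sum.inl 0) * X (Sum.inr ⟨0, hm0⟩))) ≠ 0 := by
      by_contra! hcon
      exact mul_ne_zero h (mul_ne_zero (X_ne_zero _) (X_ne_zero _))
        (MvPolynomial.funext fun s => by rw [hcon s, map_zero])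
    simp only [map_mul, eval_X, mul_ne_zero_iff] at hs
    obtain ⟨hs1, hs2, hs3⟩ := hs
    have ht : s ∘ Sum.inl ≠ 0 := fun h0 => hs2 (congrFun h0 0)
    have hu : s ∘ Sum.inr ≠ 0 := fun h0 => hs3 (congrFun h0 ⟨0, hm0⟩)
    refine ⟨Projectivization.mk ℂ _ ht, Projectivization.mk ℂ _ hu, le_antisymm
      (rank_jacobian_le A B _ (Projectivization.rep_nonzero _) hm) ?_⟩
    obtain ⟨a, ha⟩ := Projectivization.exists_smul_eq_mk_rep ℂ _ ht
    obtain ⟨b, hb⟩ := Projectivization.exists_smul_eq_mk_rep ℂ _ hu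
    rw [← ha, ← hb, Units.smul_def, Units.smul_def, jacobian_smul,
      Matrix.rank_mul_eq_left_of_det_ne_zero]
    · rw [eval_det_genericJacobian] at hs1
      have := Matrix.rank_of_det_ne_zero hs1
      rw [Fintype.card_fin] at this
      exact this.symm.le.trans (Matrix.rank_submatrix_le _ _ _)
    · rw [Matrix.det_diagonal]
      refine Finset.prod_ne_zero_iff.2 ?_
      rintro (k | k) -
      · exact b.ne_zero
      · exact a.ne_zero

end PSpace

end

/-! ### The main theorem -/

theorem mainTheorem10 (n d : ℕ) (hd : d < n)
    (L : Submodule ℂ (Fin (n + 1) → ℂ)) (hL : Module.finrank ℂ L = d + 1)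
    (hcoord : ∀ i, ∃ x ∈ L, x i ≠ 0)
    (A : Matrix (Fin (d + 1)) (Fin (n + 1)) ℂ)
    (hA : Submodule.span ℂ (Set.range A.row) = L)
    (B : Matrix (Fin (n + 1)) (Fin (n - d)) ℂ)
    (hBindep : LinearIndependent ℂ B.col)
    (hBspan : Submodule.span ℂ (Set.range B.col) = LinearMap.ker A.mulVecLin)
    (hcoloop : ∀ i, ¬ (PSpace.matroid L).IsColoop i) :
    (PSpace.IsDualDefective (PSpace.reciprocal L) ↔
      ∀ (r : Fin n ↪ Fin (n + 1)) (c : Fin n ↪ Fin (d + 1) ⊕ Fin (n - d)),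
        ((PSpace.genericJacobian A B).submatrix r c).det = 0) ∧
    (PSpace.IsHypersurface (PSpace.dualVariety (PSpace.reciprocal L)) ↔
      ∃ (t : ℙ ℂ (Fin (d + 1) → ℂ)) (u : ℙ ℂ (Fin (n - d) → ℂ)),
        (PSpace.jacobian A B t.rep u.rep).rank = n) := by
  have hm0 : 0 < n - d := by omega
  have hm : d + 1 + (n - d) = n + 1 := by omega
  have hB : B ≠ 0 := by
    rintro rfl
    exact hBindep.ne_zero ⟨0, hm0⟩ rfl
  have hx := PSpace.spaceCoord_ne_zero (m := n - d) hA hcoord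
  have hy0 := PSpace.dualParam_ne_zero hA hcoord hB
  have e : Fin (n + 1) ≃ Fin (d + 1) ⊕ Fin (n - d) :=
    (finCongr hm.symm).trans finSumFinEquiv.symm
  have hdep := PSpace.not_algebraicIndependent_dualParam (B := B) hx e
  have hhyp : PSpace.IsHypersurface (PSpace.imageClosure (PSpace.dualParam A B)) ↔ _ :=
    (PSpace.isHypersurface_imageClosure_iff hy0 (by norm_num)
      (PSpace.isHomogeneous_dualParam A B) hdep).trans
        (PSpace.exists_algebraicIndependent_dualParam_iff hx e)
  rw [PSpace.IsDualDefective, PSpace.dualVariety_reciprocal_eq hA hBspan hcoord hB,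
    PSpace.one_lt_codim_imageClosure_iff hy0 (by norm_num) (PSpace.isHomogeneous_dualParam A B)
      hdep, PSpace.exists_rank_jacobian_eq_iff A B hm hm0]
  refine ⟨?_, hhyp⟩
  rw [hhyp]
  push Not
  rfl
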